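/- An instance of bagUFP consists of a path with nodes $0,1,\dots,m$ and edges $(e,e+1)$, $0\le e<m$, with positive integer edge capacities $u_e$, together with $n$ tasks partitioned into bags. Task $i$ has a positive integer weight $w_i$, a positive integer demand $d_i$, and a subpath from node $s_i$ to node $t_i$, where $0\le s_i<t_i\le m$. A set of tasks is feasible if it contains at most one task of each bag and if, for every edge $(e,e+1)$, the total demand of the selected tasks $i$ whose subpath contains this edge ($s_i\le e<t_i$) is at most $u_e$. The goal is to find a feasible set of maximum total weight. The problem is called unweighted if all tasks have the same weight, that is, if the goal is to maximize the number of selected tasks. Theorem. There is a $69$-approximation algorithm for unweighted bagUFP: a deterministic algorithm that, on every instance of bagUFP in which all weights are equal, runs in time polynomial in the size of the instance (all numbers written in binary) and returns a feasible set of tasks whose total weight is at least $\mathrm{opt}/69$, where $\mathrm{opt}$ is the maximum total weight of a feasible set of tasks. -/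

import Mathlib

/-! ### A random access machine with logarithmic cost -/

namespace RAM

/-- Memory of the machine: registers `reg x` and arrays `mem a`, all holding natural numbers of
arbitrary size. A given program mentions only finitely many register and array names. -/
structure State where
  reg : ℕ → ℕ
  mem : ℕ → ℕ → ℕ

/-- Arithmetic expressions; `arr a e` is the content of cell `e` of array `a`, and
`sub` is truncated subtraction. -/
inductive Expr where
  | const (c : ℕ)
  | var (x : ℕ)
  | arr (a : ℕ) (e : Expr)
  | add (e₁ e₂ : Expr)
  | sub (e₁ e₂ : Expr)
  | mul (e₁ e₂ : Expr)

/-- The value of an expression. -/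
def Expr.eval (σ : State) : Expr → ℕ
  | const c => c
  | var x => σ.reg x
  | arr a e => σ.mem a (e.eval σ)
  | add e₁ e₂ => e₁.eval σ + e₂.eval σ
  | sub e₁ e₂ => e₁.eval σ - e₂.eval σ
  | mul e₁ e₂ => e₁.eval σ * e₂.eval σ

/-- The logarithmic cost of evaluating an expression: every elementary operation costs one unit
plus the bit lengths (`Nat.size`) of all numbers it handles, addresses included. -/
def Expr.cost (σ : State) : Expr → ℕ
  | const c => 1 + Nat.size c
  | var x => 1 + Nat.size (σ.reg x)
  | arr a e => e.cost σ + 1 + Nat.size (e.eval σ) + Nat.size (σ.mem a (e.eval σ))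
  | add e₁ e₂ => e₁.cost σ + e₂.cost σ + 1 + Nat.size (e₁.eval σ) + Nat.size (e₂.eval σ)
  | sub e₁ e₂ => e₁.cost σ + e₂.cost σ + 1 + Nat.size (e₁.eval σ) + Nat.size (e₂.eval σ)
  | mul e₁ e₂ => e₁.cost σ + e₂.cost σ + 1 + Nat.size (e₁.eval σ) + Nat.size (e₂.eval σ)

/-- Programs. Tests ask whether an expression is nonzero. -/
inductive Prog where
  | skip
  | assign (x : ℕ) (e : Expr)
  | store (a : ℕ) (idx e : Expr)
  | seq (p q : Prog)
  | ite (e : Expr) (p q : Prog)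
  | while (e : Expr) (p : Prog)

/-- `reg x := v`. -/
def State.setReg (σ : State) (x v : ℕ) : State where
  reg := Function.update σ.reg x v
  mem := σ.mem

/-- `mem a i := v`. -/
def State.setMem (σ : State) (a i v : ℕ) : State where
  reg := σ.reg
  mem := Function.update σ.mem a (Function.update (σ.mem a) i v)

/-- `Exec p σ σ' k`: started in state `σ`, the program `p` halts in state `σ'` and its run has
total logarithmic cost `k`. -/
inductive Exec : Prog → State → State → ℕ → Prop where
  | skip (σ : State) : Exec .skip σ σ 1
  | assign (σ : State) (x : ℕ) (e : Expr) :
      Exec (.assign x e) σ (σ.setReg x (e.eval σ)) (e.cost σ + 1 + Nat.size (e.eval σ))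
  | store (σ : State) (a : ℕ) (idx e : Expr) :
      Exec (.store a idx e) σ (σ.setMem a (idx.eval σ) (e.eval σ))
        (idx.cost σ + e.cost σ + 1 + Nat.size (idx.eval σ) + Nat.size (e.eval σ))
  | seq {p q : Prog} {σ σ₁ σ₂ : State} {k₁ k₂ : ℕ} :
      Exec p σ σ₁ k₁ → Exec q σ₁ σ₂ k₂ → Exec (.seq p q) σ σ₂ (k₁ + k₂)
  | ite_true {e : Expr} {p q : Prog} {σ σ' : State} {k : ℕ} :
      e.eval σ ≠ 0 → Exec p σ σ' k → Exec (.ite e p q) σ σ' (e.cost σ + 1 + k)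
  | ite_false {e : Expr} {p q : Prog} {σ σ' : State} {k : ℕ} :
      e.eval σ = 0 → Exec q σ σ' k → Exec (.ite e p q) σ σ' (e.cost σ + 1 + k)
  | while_true {e : Expr} {p : Prog} {σ σ₁ σ₂ : State} {k₁ k₂ : ℕ} :
      e.eval σ ≠ 0 → Exec p σ σ₁ k₁ → Exec (.while e p) σ₁ σ₂ k₂ →
        Exec (.while e p) σ σ₂ (e.cost σ + 1 + k₁ + k₂)
  | while_false {e : Expr} {p : Prog} {σ : State} :
      e.eval σ = 0 → Exec (.while e p) σ σ (e.cost σ + 1)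

/-- The finite sequence `f` as the initial content of an array, padded with zeros. -/
def toArray {k : ℕ} (f : Fin k → ℕ) : ℕ → ℕ :=
  fun i => if h : i < k then f ⟨i, h⟩ else 0

end RAM

/-! ### Unsplittable flow on a path with bags -/

/-- An instance of bagUFP: a path with nodes `0, …, m` and edges `e = (e, e + 1)` for `e < m`,
with positive integer edge capacities, and `n` tasks; task `i` has a positive integer weight,
a positive integer demand, and the subpath from node `source i` to node `target i`. Tasks with the
same label `bag i` form one bag. -/
structure BagUFP where
  m : ℕ
  n : ℕ
  capacity : Fin m → ℕ
  capacity_pos : ∀ e, 0 < capacity e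
  source : Fin n → ℕ
  target : Fin n → ℕ
  source_lt_target : ∀ i, source i < target i
  target_le : ∀ i, target i ≤ m
  demand : Fin n → ℕ
  demand_pos : ∀ i, 0 < demand i
  weight : Fin n → ℕ
  weight_pos : ∀ i, 0 < weight i
  bag : Fin n → ℕ

namespace BagUFP

/-- All tasks have the same weight. -/
def Unweighted (I : BagUFP) : Prop := ∀ i j, I.weight i = I.weight j

/-- Edge `e` lies on the subpath of task `i`. -/
def Uses (I : BagUFP) (i : Fin I.n) (e : Fin I.m) : Prop :=
  I.source i ≤ (e : ℕ) ∧ (e : ℕ) < I.target i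

open Classical in
/-- A set of tasks is feasible if on each edge the total demand of the selected tasks using it is
at most its capacity, and at most one task of each bag is selected. -/
def Feasible (I : BagUFP) (S : Finset (Fin I.n)) : Prop :=
  (∀ e, ∑ i ∈ S with I.Uses i e, I.demand i ≤ I.capacity e) ∧
  (∀ i ∈ S, ∀ j ∈ S, I.bag i = I.bag j → i = j)

/-- Total weight of a set of tasks. -/
def totalWeight (I : BagUFP) (S : Finset (Fin I.n)) : ℕ := ∑ i ∈ S, I.weight i

open Classical in
/-- The maximum total weight of a feasible set of tasks. -/
noncomputable def opt (I : BagUFP) : ℕ :=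
  (Finset.univ.filter fun S : Finset (Fin I.n) => I.Feasible S).sup I.totalWeight

/-- The size of the instance: the number of bits needed to write down all its numbers in binary
(with one extra unit per number as a separator). -/
def size (I : BagUFP) : ℕ :=
  (Nat.size I.m + 1) + (Nat.size I.n + 1) + (∑ e, (Nat.size (I.capacity e) + 1)) +
    ∑ i, ((Nat.size (I.source i) + 1) + (Nat.size (I.target i) + 1) +
      (Nat.size (I.demand i) + 1) + (Nat.size (I.weight i) + 1) + (Nat.size (I.bag i) + 1))

/-- The initial state of the machine on input `I`: registers `0`, `1` hold `m`, `n`, arrays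
`0, …, 5` hold the capacities, sources, targets, demands, weights and bag labels, and everything
else is zero. -/
def inputState (I : BagUFP) : RAM.State where
  reg
    | 0 => I.m
    | 1 => I.n
    | _ => 0
  mem
    | 0 => RAM.toArray I.capacity
    | 1 => RAM.toArray I.source
    | 2 => RAM.toArray I.target
    | 3 => RAM.toArray I.demand
    | 4 => RAM.toArray I.weight
    | 5 => RAM.toArray I.bag
    | _ => fun _ => 0

/-- The set of tasks that a final state represents: task `i` is selected if and only if cell `i`
of array `6` is nonzero. -/
def output (I : BagUFP) (σ : RAM.State) : Finset (Fin I.n) :=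
  Finset.univ.filter fun i => σ.mem 6 i ≠ 0

/-- `p` is an `α`-approximation algorithm for bagUFP restricted to the instances satisfying `C`:
in time polynomial in the size of the instance it halts with a feasible set of tasks
whose total weight is at least `opt / α`. -/
def IsApproximationAlgorithm (C : BagUFP → Prop) (α : ℕ) (p : RAM.Prog) : Prop :=
  ∃ q : Polynomial ℕ, ∀ I : BagUFP, C I → ∃ (σ : RAM.State) (k : ℕ),
    RAM.Exec p I.inputState σ k ∧ k ≤ q.eval I.size ∧
    I.Feasible (I.output σ) ∧ I.opt ≤ α * I.totalWeight (I.output σ)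

end BagUFP

namespace BagUFP

/-! ### Bottlenecks -/

variable (I : BagUFP)

/-! Write `b` for the bottleneck capacity of a task and `d` for its demand. Tasks are split into
small (`4d ≤ b`), medium (`2d ≤ b < 4d`) and large (`b < 2d`). Four feasible sets are computed: `S`
from small tasks, `B` from medium ones, `A` from large ones, and a set `G` of tasks with disjoint
paths. Every feasible `O` satisfies `|O| ≤ 30|S| + 17|B| + 17|A| + 5|G|`
(`Feasible.card_le_of_parts`), so the largest of the four is within the factor `69 = 30 + 17 + 17 +
5`. With equal weights, cardinality decides.

The common tool is that the tasks of `O` on one edge form two stacks (`Feasible.exists_stacked`),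
according to the side on which a bottleneck edge of the task lies. In a stack all demands together
fit below the bottleneck of one member, which bounds both counts and sums of `d / b`.

For medium and large tasks a task becomes the rectangle of heights `[b - d, b)` over its path.
Disjoint rectangles from distinct bags form a feasible set, so greedy sets are feasible
(`IsGreedy.feasible`). Each task of `O` is charged to a greedy task that it conflicts with; a bag
conflict costs one task, and geometric conflicts are counted on end edges of the greedy task. For
large tasks lying strictly inside the path of their greedy task a second charging is needed, and
what remains after it has intersecting rectangles whenever paths overlap, so that it compares with
disjoint intervals (`Feasible.card_le_of_large`).

For small tasks a local ratio argument is used. Tasks are scanned by right end and raised until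
covered; a reverse scan selects `S` with dyadic windows of bottlenecks, each window filling at most
half of its capacity, so that the windows sum geometrically. Each unit of raise pays for at most 25
units of share in `O` and for at least 1 in `S`, while coverage lies between 5 and 6, which gives
`25 · 6 / 5 = 30` (`IsLocalRatio.card_le`).

Running time: the algorithm is a program of for-loops bounded by `m` and `n` that stores only values
of product-free expressions, so bit lengths grow additively and the total cost is polynomial
(`Code.exists_polynomial_bound`). -/

/-- The smallest capacity of an edge on the path of task `i`. -/
noncomputable def bot (i : Fin I.n) : ℕ := sInf {c | ∃ e, I.Uses i e ∧ I.capacity e = c}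

theorem exists_bot (i : Fin I.n) : ∃ e, I.Uses i e ∧ I.capacity e = I.bot i := by
  have h : ({c | ∃ e, I.Uses i e ∧ I.capacity e = c} : Set ℕ).Nonempty :=
    ⟨_, ⟨I.source i, (I.source_lt_target i).trans_le (I.target_le i)⟩,
      ⟨le_rfl, I.source_lt_target i⟩, rfl⟩
  exact Nat.sInf_mem h

variable {I}

theorem bot_le {i : Fin I.n} {e : Fin I.m} (h : I.Uses i e) : I.bot i ≤ I.capacity e :=
  Nat.sInf_le ⟨e, h, rfl⟩

theorem bot_eq {i : Fin I.n} {e : Fin I.m} (h : I.Uses i e)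
    (hmin : ∀ f, I.Uses i f → I.capacity e ≤ I.capacity f) : I.bot i = I.capacity e := by
  obtain ⟨f, hf, hc⟩ := I.exists_bot i
  exact le_antisymm (bot_le h) (hc ▸ hmin f hf)

theorem bot_pos (i : Fin I.n) : 0 < I.bot i := by
  obtain ⟨e, -, h⟩ := I.exists_bot i
  exact h ▸ I.capacity_pos e

theorem bot_le_bot {i j : Fin I.n} (hs : I.source j ≤ I.source i) (ht : I.target i ≤ I.target j) :
    I.bot j ≤ I.bot i := by
  obtain ⟨e, he, h⟩ := I.exists_bot i
  exact h ▸ bot_le ⟨hs.trans he.1, he.2.trans_le ht⟩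

theorem Feasible.demand_le_bot {O : Finset (Fin I.n)} (hO : I.Feasible O) {i : Fin I.n}
    (hi : i ∈ O) : I.demand i ≤ I.bot i := by
  classical
  obtain ⟨e, he, h⟩ := I.exists_bot i
  rw [← h]
  refine le_trans ?_ (hO.1 e)
  exact Finset.single_le_sum (f := I.demand) (fun _ _ => Nat.zero_le _) (by simp [hi, he])

open Classical in
theorem Feasible.mono {O T : Finset (Fin I.n)} (hO : I.Feasible O) (h : T ⊆ O) : I.Feasible T :=
  ⟨fun e => (Finset.sum_le_sum_of_subset (Finset.filter_subset_filter _ h)).trans (hO.1 e),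
    fun i hi j hj => hO.2 i (h hi) j (h hj)⟩

variable (I) in
/-- The first edge of task `i`. -/
def firstEdge (i : Fin I.n) : Fin I.m :=
  ⟨I.source i, (I.source_lt_target i).trans_le (I.target_le i)⟩

variable (I) in
/-- The last edge of task `i`. -/
def lastEdge (i : Fin I.n) : Fin I.m :=
  ⟨I.target i - 1, by have := I.source_lt_target i; have := I.target_le i; omega⟩

/-- This is why scans go by right end: the tasks charged to an earlier task all meet on its last
edge, where the two-stack bound applies. -/
theorem uses_lastEdge {i j : Fin I.n} (hs : I.source i < I.target j)
    (ht : I.target j ≤ I.target i) : I.Uses i (I.lastEdge j) := by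
  simp only [Uses, lastEdge]; omega

/-! ### Stacks of tasks on an edge -/

/-- A set of tasks in which every nonempty subset fits below the bottleneck of one of its
members. -/
def Stacked (T : Finset (Fin I.n)) : Prop :=
  ∀ U ⊆ T, U.Nonempty → ∃ o ∈ U, ∑ i ∈ U, I.demand i ≤ I.bot o

theorem Stacked.mono {T U : Finset (Fin I.n)} (hT : Stacked T) (h : U ⊆ T) : Stacked U :=
  fun V hV => hT V (hV.trans h)

open Classical in
theorem Feasible.stacked_of_uses {O T : Finset (Fin I.n)} (hO : I.Feasible O) (hT : T ⊆ O)
    (h : ∀ U ⊆ T, U.Nonempty → ∃ o ∈ U, ∃ f, I.capacity f = I.bot o ∧ ∀ i ∈ U, I.Uses i f) :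
    Stacked T := by
  intro U hU hne
  obtain ⟨o, ho, f, hf, hu⟩ := h U hU hne
  refine ⟨o, ho, hf ▸ le_trans ?_ (hO.1 f)⟩
  refine Finset.sum_le_sum_of_subset fun i hi => ?_
  simp only [Finset.mem_filter]
  exact ⟨hT (hU hi), hu i hi⟩

open Classical in
/-- The tasks of a feasible set using a given edge form two stacks. -/
theorem Feasible.exists_stacked {O : Finset (Fin I.n)} (hO : I.Feasible O) (e : Fin I.m) :
    ∃ T₁ T₂, Stacked T₁ ∧ Stacked T₂ ∧ ∀ i ∈ O, I.Uses i e → i ∈ T₁ ∪ T₂ := by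
  -- Fix a bottleneck edge `f i` for each task. Among tasks through `e` with `f i` to the right, the
  -- one with the leftmost `f` has its bottleneck edge on the paths of all the others, so its
  -- capacity bounds the total demand; the left side is symmetric.
  choose f hf hc using I.exists_bot
  refine ⟨O.filter fun i => I.Uses i e ∧ e ≤ f i, O.filter fun i => I.Uses i e ∧ f i ≤ e,
    ?_, ?_, ?_⟩
  · refine hO.stacked_of_uses (Finset.filter_subset _ _) fun U hU hne => ?_
    obtain ⟨o, ho, hmin⟩ := Finset.exists_min_image U f hne
    refine ⟨o, ho, f o, hc o, fun i hi => ?_⟩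
    have h1 := (Finset.mem_filter.1 (hU hi)).2
    have h2 := (Finset.mem_filter.1 (hU ho)).2
    have h3 := hmin i hi
    have h4 := hf i
    simp only [Uses, Fin.le_def] at *
    omega
  · refine hO.stacked_of_uses (Finset.filter_subset _ _) fun U hU hne => ?_
    obtain ⟨o, ho, hmax⟩ := Finset.exists_max_image U f hne
    refine ⟨o, ho, f o, hc o, fun i hi => ?_⟩
    have h1 := (Finset.mem_filter.1 (hU hi)).2
    have h2 := (Finset.mem_filter.1 (hU ho)).2
    have h3 := hmax i hi
    have h4 := hf i
    simp only [Uses, Fin.le_def] at *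
    omega
  · intro i hi hu
    rcases le_total e (f i) with h | h <;> simp [hi, hu, h]

-- The two stacks may share tasks (those whose chosen bottleneck edge is `e` itself), so this is a
-- union bound and needs nonnegative weights.
open Classical in
theorem Feasible.sum_le_two_mul {O T : Finset (Fin I.n)} (hO : I.Feasible O) (hT : T ⊆ O)
    {e : Fin I.m} (he : ∀ i ∈ T, I.Uses i e) {w : Fin I.n → ℚ} (hw : ∀ i, 0 ≤ w i) {c : ℚ}
    (h : ∀ U ⊆ T, Stacked U → ∑ i ∈ U, w i ≤ c) : ∑ i ∈ T, w i ≤ 2 * c := by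
  obtain ⟨T₁, T₂, h₁, h₂, hcov⟩ := hO.exists_stacked e
  have hsub : T ⊆ T ∩ T₁ ∪ T ∩ T₂ := fun i hi => by
    have := hcov i (hT hi) (he i hi)
    simp only [Finset.mem_union, Finset.mem_inter] at *
    tauto
  have e1 := h _ Finset.inter_subset_left (h₁.mono (Finset.inter_subset_right (s₁ := T)))
  have e2 := h _ Finset.inter_subset_left (h₂.mono (Finset.inter_subset_right (s₁ := T)))
  have e3 : ∑ i ∈ T, w i ≤ ∑ i ∈ T ∩ T₁ ∪ T ∩ T₂, w i :=
    Finset.sum_le_sum_of_subset_of_nonneg hsub fun i _ _ => hw i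
  have e4 : ∑ i ∈ T ∩ T₁ ∪ T ∩ T₂, w i ≤ ∑ i ∈ T ∩ T₁, w i + ∑ i ∈ T ∩ T₂, w i := by
    rw [← Finset.sum_union_inter]
    exact le_add_of_nonneg_right (Finset.sum_nonneg fun i _ => hw i)
  linarith

theorem Feasible.card_le_two_mul {O T : Finset (Fin I.n)} (hO : I.Feasible O) (hT : T ⊆ O)
    {e : Fin I.m} (he : ∀ i ∈ T, I.Uses i e) {c : ℕ}
    (h : ∀ U ⊆ T, Stacked U → U.card ≤ c) : T.card ≤ 2 * c := by
  have := hO.sum_le_two_mul hT he (w := fun _ => 1) (fun _ => zero_le_one) (c := c)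
    fun U hU hs => by simpa using h U hU hs
  simp only [Finset.sum_const, nsmul_eq_mul, mul_one] at this
  exact_mod_cast this

/-- A stack of tasks of demand at least a fraction of `h` whose rectangles reach below
height `h` is small. -/
theorem Stacked.card_le {T : Finset (Fin I.n)} (hT : Stacked T) {h c : ℕ} (hc : 0 < c)
    (h₁ : ∀ i ∈ T, I.bot i < h + I.demand i) (h₂ : ∀ i ∈ T, h ≤ c * I.demand i) :
    T.card ≤ c := by
  classical
  rcases T.eq_empty_or_nonempty with rfl | hne
  · simp
  -- Everything except `o` has total demand below `h`, while each member has at least `h / c`; hence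
  -- fewer than `c` others.
  obtain ⟨o, ho, hle⟩ := hT T subset_rfl hne
  rw [← Finset.add_sum_erase _ _ ho] at hle
  have hlt : ∑ i ∈ T.erase o, I.demand i < h := by have := h₁ o ho; omega
  have e1 : (T.erase o).card * h ≤ c * ∑ i ∈ T.erase o, I.demand i := by
    rw [Finset.mul_sum, ← smul_eq_mul]
    exact Finset.card_nsmul_le_sum _ _ _ fun i hi => h₂ i (Finset.mem_of_mem_erase hi)
  have e2 : (T.erase o).card * h < c * h := e1.trans_lt (Nat.mul_lt_mul_of_pos_left hlt hc)
  have e3 := Nat.lt_of_mul_lt_mul_right e2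
  rw [Finset.card_erase_of_mem ho] at e3
  omega

/-! ### Greedy sets -/

/-- Tasks `i` and `j` have intersecting paths. -/
def Overlap (i j : Fin I.n) : Prop := I.source i < I.target j ∧ I.source j < I.target i

/-- Tasks `i` and `j` lie in the same bag, or their rectangles, which reach from height `lo` to the
bottleneck capacity, intersect. -/
def Conflict (lo : Fin I.n → ℕ) (i j : Fin I.n) : Prop :=
  I.bag i = I.bag j ∨ (Overlap i j ∧ lo i < I.bot j ∧ lo j < I.bot i)

theorem Overlap.symm {i j : Fin I.n} (h : Overlap i j) : Overlap j i := ⟨h.2, h.1⟩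

theorem Conflict.symm {lo : Fin I.n → ℕ} {i j : Fin I.n} (h : Conflict lo i j) :
    Conflict lo j i :=
  h.imp Eq.symm fun h => ⟨h.1.symm, h.2.2, h.2.1⟩

theorem overlap_of_uses {i j : Fin I.n} {e : Fin I.m} (hi : I.Uses i e) (hj : I.Uses j e) :
    Overlap i j := by
  simp only [Uses, Overlap] at *; omega

/-- A set obtained by scanning the eligible tasks in the order of `key` and taking every task
without conflict with those taken before. -/
structure IsGreedy (elig : Fin I.n → Prop) (lo key : Fin I.n → ℕ) (G : Finset (Fin I.n)) :
    Prop where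
  eligible : ∀ i ∈ G, elig i
  indep : ∀ i ∈ G, ∀ j ∈ G, i ≠ j → ¬ Conflict lo i j
  exists_conflict : ∀ i, elig i → ∃ a ∈ G, key a ≤ key i ∧ Conflict lo i a

-- Over an edge the height intervals `[lo i, bot i)` of the chosen tasks are disjoint, lie below the
-- capacity, and are at least as long as the demands.
open Classical in
theorem IsGreedy.feasible {elig : Fin I.n → Prop} {lo key : Fin I.n → ℕ} {G : Finset (Fin I.n)}
    (hG : IsGreedy elig lo key G) (hlo : ∀ i, elig i → lo i + I.demand i ≤ I.bot i) :
    I.Feasible G := by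
  refine ⟨fun e => ?_, fun i hi j hj h => by_contra fun hne => hG.indep i hi j hj hne (Or.inl h)⟩
  calc ∑ i ∈ G with I.Uses i e, I.demand i
      ≤ ∑ i ∈ G with I.Uses i e, (Finset.Ico (lo i) (I.bot i)).card := by
        refine Finset.sum_le_sum fun i hi => ?_
        have := hlo i (hG.eligible i (Finset.mem_filter.1 hi).1)
        rw [Nat.card_Ico]; omega
    _ = ((G.filter fun i => I.Uses i e).biUnion fun i => Finset.Ico (lo i) (I.bot i)).card := by
        refine (Finset.card_biUnion fun i hi j hj hne => ?_).symm
        rw [Finset.mem_coe, Finset.mem_filter] at hi hj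
        have := hG.indep i hi.1 j hj.1 hne
        refine Finset.disjoint_left.2 fun x hx hy => ?_
        rw [Finset.mem_Ico] at hx hy
        exact this (Or.inr ⟨overlap_of_uses hi.2 hj.2, by omega, by omega⟩)
    _ ≤ (Finset.range (I.capacity e)).card := by
        refine Finset.card_le_card fun x hx => ?_
        simp only [Finset.mem_biUnion, Finset.mem_filter, Finset.mem_Ico] at hx
        obtain ⟨i, hi, hx⟩ := hx
        exact Finset.mem_range.2 (hx.2.trans_le (bot_le hi.2))
    _ = I.capacity e := Finset.card_range _

/-! ### Charging a feasible set to greedy sets. -/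

theorem Feasible.card_le_of_bag {O A : Finset (Fin I.n)} (hO : I.Feasible O)
    {f : Fin I.n → Fin I.n} (hf : ∀ o ∈ O, f o ∈ A) (hb : ∀ o ∈ O, I.bag o = I.bag (f o)) :
    O.card ≤ A.card :=
  Finset.card_le_card_of_injOn f hf fun o ho o' ho' h =>
    hO.2 o ho o' ho' (by rw [hb o ho, hb o' ho', h])

/-- Take `h` to be the least bottleneck in `T`: all rectangles reach below `h`, and all demands
exceed `h / 2`, so each of the two stacks has at most two tasks. -/
theorem Feasible.card_le_four {O T : Finset (Fin I.n)} (hO : I.Feasible O) (hT : T ⊆ O)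
    {e : Fin I.m} (he : ∀ i ∈ T, I.Uses i e) (hl : ∀ i ∈ T, I.bot i < 2 * I.demand i)
    (hx : ∀ i ∈ T, ∀ j ∈ T, I.bot i - I.demand i < I.bot j) : T.card ≤ 4 := by
  rcases T.eq_empty_or_nonempty with rfl | hne
  · simp
  obtain ⟨o, ho, hmin⟩ := Finset.exists_min_image T I.bot hne
  refine hO.card_le_two_mul (c := 2) hT he fun U hU hs => hs.card_le (h := I.bot o) (by norm_num)
    (fun i hi => ?_) fun i hi => ?_
  · have := hx i (hU hi) o ho; omega
  · have := hmin i (hU hi); have := hl i (hU hi); omega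

/-- Rectangle sets of large tasks in which overlapping tasks intersect, compared with a greedy
set of disjoint intervals. -/
theorem Feasible.card_le_five_mul {O G : Finset (Fin I.n)} (hO : I.Feasible O)
    (hl : ∀ i ∈ O, I.bot i < 2 * I.demand i)
    (hx : ∀ i ∈ O, ∀ j ∈ O, Overlap i j → I.bot i - I.demand i < I.bot j)
    (hG : IsGreedy (fun i => I.demand i ≤ I.bot i) (fun _ => 0) I.target G) :
    O.card ≤ 5 * G.card := by
  classical
  choose! g hgG hgt hgc using fun i (hi : i ∈ O) => hG.exists_conflict i (hO.demand_le_bot hi)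
  have h1 : (O.filter fun o => I.bag o = I.bag (g o)).card ≤ G.card :=
    (hO.mono (Finset.filter_subset _ _)).card_le_of_bag
      (fun o ho => hgG o (Finset.mem_filter.1 ho).1) fun o ho => (Finset.mem_filter.1 ho).2
  -- The greedy task ends no later than the tasks charged to it, so these share its last edge; there
  -- they overlap pairwise, hence intersect, and number at most four.
  have h2 : (O.filter fun o => ¬ I.bag o = I.bag (g o)).card ≤ 4 * G.card := by
    refine Finset.card_le_mul_card_image_of_maps_to (f := g)
      (fun o ho => hgG o (Finset.mem_filter.1 ho).1) 4 fun a _ => ?_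
    have hu : ∀ i ∈ (O.filter fun o => ¬ I.bag o = I.bag (g o)).filter (g · = a),
        I.Uses i (I.lastEdge a) := by
      intro i hi
      simp only [Finset.mem_filter] at hi
      obtain ⟨⟨hiO, hb⟩, rfl⟩ := hi
      exact uses_lastEdge ((hgc i hiO).resolve_left hb).1.1 (hgt i hiO)
    have hsub : (O.filter fun o => ¬ I.bag o = I.bag (g o)).filter (g · = a) ⊆ O :=
      (Finset.filter_subset _ _).trans (Finset.filter_subset _ _)
    exact hO.card_le_four hsub hu (fun i hi => hl i (hsub hi))
      fun i hi j hj => hx i (hsub hi) j (hsub hj) (overlap_of_uses (hu i hi) (hu j hj))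
  have h3 := Finset.card_filter_add_card_filter_not (s := O) fun o => I.bag o = I.bag (g o)
  omega

/-- Medium tasks. -/
theorem Feasible.card_le_of_medium {O B : Finset (Fin I.n)} (hO : I.Feasible O)
    (hm : ∀ i ∈ O, 2 * I.demand i ≤ I.bot i ∧ I.bot i < 4 * I.demand i)
    (hB : IsGreedy (fun i => 2 * I.demand i ≤ I.bot i ∧ I.bot i < 4 * I.demand i)
      (fun i => I.bot i - I.demand i) I.target B) :
    O.card ≤ 17 * B.card := by
  classical
  choose! g hgG hgt hgc using fun i (hi : i ∈ O) => hB.exists_conflict i (hm i hi)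
  have h1 : (O.filter fun o => I.bag o = I.bag (g o)).card ≤ B.card :=
    (hO.mono (Finset.filter_subset _ _)).card_le_of_bag
      (fun o ho => hgG o (Finset.mem_filter.1 ho).1) fun o ho => (Finset.mem_filter.1 ho).2
  have h2 : (O.filter fun o => ¬ I.bag o = I.bag (g o)).card ≤ 16 * B.card := by
    refine Finset.card_le_mul_card_image_of_maps_to (f := g)
      (fun o ho => hgG o (Finset.mem_filter.1 ho).1) 16 fun a ha => ?_
    have hu : ∀ i ∈ (O.filter fun o => ¬ I.bag o = I.bag (g o)).filter (g · = a),
        i ∈ O ∧ I.Uses i (I.lastEdge a) ∧ I.bot i - I.demand i < I.bot a ∧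
          I.bot a - I.demand a < I.bot i := by
      intro i hi
      simp only [Finset.mem_filter] at hi
      obtain ⟨⟨hiO, hb⟩, rfl⟩ := hi
      have := (hgc i hiO).resolve_left hb
      exact ⟨hiO, uses_lastEdge this.1.1 (hgt i hiO), this.2⟩
    have ham := hB.eligible a ha
    -- The constant 8: `a` is medium, so `bot a / 2 ≤ bot a - demand a < bot i < 4 * demand i`.
    refine hO.card_le_two_mul (c := 8) (fun i hi => (hu i hi).1) (fun i hi => (hu i hi).2.1)
      fun U hU hs => hs.card_le (h := I.bot a) (by norm_num) (fun i hi => ?_) fun i hi => ?_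
    · have := hu i (hU hi); omega
    · have h := hu i (hU hi); have := hm i h.1; omega
  have h3 := Finset.card_filter_add_card_filter_not (s := O) fun o => I.bag o = I.bag (g o)
  omega

/-- Large tasks. -/
theorem Feasible.card_le_of_large {O A G : Finset (Fin I.n)} (hO : I.Feasible O)
    (hl : ∀ i ∈ O, I.bot i < 2 * I.demand i)
    (hA : IsGreedy (fun i => I.demand i ≤ I.bot i ∧ I.bot i < 2 * I.demand i)
      (fun i => I.bot i - I.demand i) I.bot A)
    (hG : IsGreedy (fun i => I.demand i ≤ I.bot i) (fun _ => 0) I.target G) :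
    O.card ≤ 17 * A.card + 5 * G.card := by
  classical
  choose! g hgA hgb hgc using
    fun i (hi : i ∈ O) => hA.exists_conflict i ⟨hO.demand_le_bot hi, hl i hi⟩
  -- tasks in the bag of a greedy task
  have h1 : (O.filter fun o => I.bag o = I.bag (g o)).card ≤ A.card :=
    (hO.mono (Finset.filter_subset _ _)).card_le_of_bag
      (fun o ho => hgA o (Finset.mem_filter.1 ho).1) fun o ho => (Finset.mem_filter.1 ho).2
  set R := O.filter fun o => ¬ I.bag o = I.bag (g o) with hR
  have hRO : R ⊆ O := Finset.filter_subset _ _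
  have hRc : ∀ i ∈ R, Overlap i (g i) ∧ I.bot i - I.demand i < I.bot (g i) := fun i hi => by
    rw [hR, Finset.mem_filter] at hi
    have := (hgc i hi.1).resolve_left hi.2
    exact ⟨this.1, this.2.1⟩
  -- tasks using an end edge of a greedy task
  have hend : ∀ E : Fin I.n → Fin I.m, (R.filter fun o => I.Uses o (E (g o))).card ≤ 4 * A.card := by
    intro E
    refine Finset.card_le_mul_card_image_of_maps_to (f := g)
      (fun o ho => hgA o (hRO (Finset.mem_filter.1 ho).1)) 4 fun a _ => ?_
    have hu : ∀ i ∈ (R.filter fun o => I.Uses o (E (g o))).filter (g · = a),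
        i ∈ R ∧ I.Uses i (E a) ∧ g i = a := by
      intro i hi
      simp only [Finset.mem_filter] at hi
      obtain ⟨⟨hiR, h⟩, rfl⟩ := hi
      exact ⟨hiR, h, rfl⟩
    refine hO.card_le_four (fun i hi => hRO (hu i hi).1) (fun i hi => (hu i hi).2.1)
      (fun i hi => hl i (hRO (hu i hi).1)) fun i hi j hj => ?_
    have e1 := hu i hi
    have e2 := hu j hj
    have e3 := (hRc i e1.1).2
    have e4 := hgb j (hRO e2.1)
    rw [e1.2.2] at e3
    rw [e2.2.2] at e4
    omega
  set J := R.filter fun o => ¬ I.Uses o (I.firstEdge (g o)) ∧ ¬ I.Uses o (I.lastEdge (g o)) with hJ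
  have hJR : J ⊆ R := Finset.filter_subset _ _
  have hinside : ∀ i a : Fin I.n, Overlap i a → ¬ I.Uses i (I.firstEdge a) →
      ¬ I.Uses i (I.lastEdge a) → I.source a ≤ I.source i ∧ I.target i ≤ I.target a := by
    intro i a h h1 h2
    simp only [Overlap, Uses, firstEdge, lastEdge] at *
    omega
  have hJin : ∀ i ∈ J, I.source (g i) ≤ I.source i ∧ I.target i ≤ I.target (g i) := by
    intro i hi
    have h := (Finset.mem_filter.1 hi).2
    exact hinside i _ (hRc i (hJR hi)).1 h.1 h.2
  have hsplit : R.card ≤ (R.filter fun o => I.Uses o (I.firstEdge (g o))).card +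
      (R.filter fun o => I.Uses o (I.lastEdge (g o))).card + J.card := by
    refine le_trans (Finset.card_le_card fun o ho => ?_) (Finset.card_union_le _ _ |>.trans
      (Nat.add_le_add_right (Finset.card_union_le _ _) _))
    simp only [hJ, Finset.mem_union, Finset.mem_filter, ho, true_and]
    tauto
  -- tasks inside a greedy task, below another such task
  set above : Fin I.n → Finset (Fin I.n) := fun k =>
    J.filter fun j => Overlap k j ∧ I.bot k ≤ I.bot j - I.demand j with habove
  set N := J.filter fun k => (above k).Nonempty with hN
  have hNJ : N ⊆ J := Finset.filter_subset _ _
  -- Second charging: `k` goes to the greedy task of a rectangle above it, with that greedy task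
  -- chosen as low as possible. The minimality is what makes the tasks charged to the same greedy
  -- task intersect.
  have hmin : ∀ k ∈ N, ∃ j ∈ above k, ∀ j' ∈ above k, I.bot (g j) ≤ I.bot (g j') := fun k hk =>
    Finset.exists_min_image (above k) (fun j => I.bot (g j)) (Finset.mem_filter.1 hk).2
  choose! c hca hcmin using hmin
  have hcJ : ∀ k ∈ N, c k ∈ J ∧ Overlap k (c k) ∧ I.bot k ≤ I.bot (c k) - I.demand (c k) :=
    fun k hk => Finset.mem_filter.1 (hca k hk)
  have hlow : ∀ k ∈ N, I.bot k < I.bot (g (c k)) := fun k hk =>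
    (hcJ k hk).2.2.trans_lt (hRc _ (hJR (hcJ k hk).1)).2
  have hNend : ∀ E : Fin I.n → Fin I.m,
      (N.filter fun k => I.Uses k (E (g (c k)))).card ≤ 4 * A.card := by
    intro E
    refine Finset.card_le_mul_card_image_of_maps_to (f := fun k => g (c k))
      (fun k hk => hgA _ (hRO (hJR (hcJ k (Finset.mem_filter.1 hk).1).1))) 4 fun a _ => ?_
    have hu : ∀ i ∈ (N.filter fun k => I.Uses k (E (g (c k)))).filter (fun k => g (c k) = a),
        i ∈ N ∧ I.Uses i (E a) ∧ g (c i) = a := by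
      intro i hi
      simp only [Finset.mem_filter] at hi
      obtain ⟨⟨hiR, h⟩, rfl⟩ := hi
      exact ⟨hiR, h, rfl⟩
    refine hO.card_le_four (fun i hi => hRO (hJR (hNJ (hu i hi).1))) (fun i hi => (hu i hi).2.1)
      (fun i hi => hl i (hRO (hJR (hNJ (hu i hi).1)))) fun i hi j hj => ?_
    have e1 := hu i hi
    have e2 := hu j hj
    -- If `i` were entirely above `j`, minimality for `j` would give `bot a ≤ bot (g i) ≤ bot i`,
    -- against `bot i < bot a`.
    by_contra hcon
    have hia : i ∈ above j := by
      simp only [habove, Finset.mem_filter]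
      exact ⟨hNJ e1.1, overlap_of_uses e2.2.1 e1.2.1, not_lt.1 hcon⟩
    have e3 := hcmin j e2.1 i hia
    have e4 := hlow i e1.1
    have e5 := hgb i (hRO (hJR (hNJ e1.1)))
    rw [e2.2.2] at e3
    rw [e1.2.2] at e4
    omega
  -- A task lying inside the path of `g (c k)` cannot have a smaller bottleneck, so `k`, which does
  -- have one, must stick out and use an end edge.
  have hNsplit : N.card ≤ (N.filter fun k => I.Uses k (I.firstEdge (g (c k)))).card +
      (N.filter fun k => I.Uses k (I.lastEdge (g (c k)))).card := by
    refine le_trans (Finset.card_le_card fun k hk => ?_) (Finset.card_union_le _ _)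
    simp only [Finset.mem_union, Finset.mem_filter, hk, true_and]
    by_contra hcon
    rw [not_or] at hcon
    have hj := hcJ k hk
    have hin := hJin _ hj.1
    have hov : Overlap k (g (c k)) := by
      have := hj.2.1
      simp only [Overlap] at *
      omega
    have := hinside k _ hov hcon.1 hcon.2
    exact absurd (hlow k hk) (not_lt.2 (bot_le_bot this.1 this.2))
  -- the remaining tasks
  have hleaf : (J.filter fun k => ¬ (above k).Nonempty).card ≤ 5 * G.card := by
    have hsub : (J.filter fun k => ¬ (above k).Nonempty) ⊆ J := Finset.filter_subset _ _
    refine (hO.mono (hsub.trans (hJR.trans hRO))).card_le_five_mul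
      (fun i hi => hl i (hRO (hJR (hsub hi)))) (fun i hi j hj hov => ?_) hG
    by_contra hcon
    refine (Finset.mem_filter.1 hj).2 ⟨i, ?_⟩
    simp only [habove, Finset.mem_filter]
    exact ⟨hsub hi, hov.symm, not_lt.1 hcon⟩
  -- The coefficient of `A` is `17 = 1 + 4 + 4 + 4 + 4`: bags, two end edges in the first charging,
  -- two end edges in the second.
  have e1 := Finset.card_filter_add_card_filter_not (s := O) fun o => I.bag o = I.bag (g o)
  have e2 := Finset.card_filter_add_card_filter_not (s := J) fun k => (above k).Nonempty
  have e3 := hend I.firstEdge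
  have e4 := hend I.lastEdge
  have e5 := hNend I.firstEdge
  have e6 := hNend I.lastEdge
  rw [← hR] at e1
  rw [← hN] at e2
  omega

end BagUFP

namespace BagUFP

/-! ### Small tasks: the local ratio method -/

variable {I : BagUFP}

/-- The bottleneck capacities of two tasks are within a factor of two. -/
def Sim (i j : Fin I.n) : Prop := I.bot i < 2 * I.bot j ∧ I.bot j < 2 * I.bot i

/-- Compare every bottleneck with `bot a`. A stack has total demand at most its largest bottleneck,
hence at most `2 * bot a` overall and at most `bot a` on the tasks with `bot i ≤ bot a`. Only the
latter need a second copy of their demand when the denominator is replaced by `bot a`; this gives `2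
+ 1`. -/
theorem Stacked.sum_div_le {T : Finset (Fin I.n)} (hT : Stacked T) {a : Fin I.n}
    (ha : ∀ i ∈ T, Sim a i) : ∑ i ∈ T, (I.demand i / I.bot i : ℚ) ≤ 3 := by
  classical
  have hle : ∀ U ⊆ T, ∀ c, (∀ i ∈ U, I.bot i ≤ c) → ∑ i ∈ U, I.demand i ≤ c := by
    intro U hU c hc
    rcases U.eq_empty_or_nonempty with rfl | hne
    · simp
    · obtain ⟨o, ho, h⟩ := hT U hU hne
      exact h.trans (hc o ho)
  set L := T.filter fun i => I.bot i ≤ I.bot a with hL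
  have h1 := hle T subset_rfl (2 * I.bot a) fun i hi => (ha i hi).2.le
  have h2 := hle L (Finset.filter_subset _ _) (I.bot a) fun i hi => (Finset.mem_filter.1 hi).2
  have hpos : (0 : ℚ) < I.bot a := by exact_mod_cast bot_pos a
  have h3 : ∑ i ∈ T, (I.demand i / I.bot i : ℚ) ≤
      ∑ i ∈ T, (I.demand i + if I.bot i ≤ I.bot a then (I.demand i : ℚ) else 0) / I.bot a := by
    refine Finset.sum_le_sum fun i hi => ?_
    have hi0 : (0 : ℚ) < I.bot i := by exact_mod_cast bot_pos i
    have hd : (0 : ℚ) ≤ I.demand i := Nat.cast_nonneg _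
    rw [div_le_div_iff₀ hi0 hpos]
    have h := ha i hi
    split_ifs with hc
    · have : (I.bot a : ℚ) ≤ 2 * I.bot i := by exact_mod_cast h.1.le
      nlinarith
    · have : (I.bot a : ℚ) ≤ I.bot i := by exact_mod_cast (not_le.1 hc).le
      nlinarith
  refine h3.trans ?_
  rw [← Finset.sum_div, div_le_iff₀ hpos, Finset.sum_add_distrib, ← Finset.sum_filter, ← hL]
  have h1' : (∑ i ∈ T, (I.demand i : ℚ)) ≤ 2 * I.bot a := by exact_mod_cast h1
  have h2' : (∑ i ∈ L, (I.demand i : ℚ)) ≤ I.bot a := by exact_mod_cast h2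
  linarith

open Classical in
/-- The result of the local ratio method. The tasks are scanned in the order of `rank` and receive
multiplicities `p`; they are scanned in the reverse order to select the set `S`. -/
structure IsLocalRatio (rank : Fin I.n → ℕ) (p : Fin I.n → ℕ) (S : Finset (Fin I.n)) : Prop where
  inj : Function.Injective rank
  target_le : ∀ i j, rank i < rank j → I.target i ≤ I.target j
  small : ∀ i, p i ≠ 0 → 4 * I.demand i ≤ I.bot i
  -- Coverage at least 5 here and below 6 in `tight`, both multiplied by `bot i` so that the
  -- algorithm can test them in natural numbers.
  cover : ∀ i, 4 * I.demand i ≤ I.bot i →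
    5 * I.bot i ≤ I.bot i * (∑ j, if rank j ≤ rank i ∧ I.bag j = I.bag i then p j else 0) +
      4 * I.demand i *
        ∑ j, if rank j < rank i ∧ Sim j i ∧ I.source i < I.target j then p j else 0
  tight : ∀ i, p i ≠ 0 →
    I.bot i * (∑ j, if rank j ≤ rank i ∧ I.bag j = I.bag i then p j else 0) +
      4 * I.demand i *
        (∑ j, if rank j < rank i ∧ Sim j i ∧ I.source i < I.target j then p j else 0) <
      6 * I.bot i
  -- For each possible window top `bot k` whose window `(bot k / 2, bot k]` contains `bot i`, the
  -- selected later tasks of the window that start before `i` ends may, together with `i`, fill only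
  -- half of `bot k`.
  mem_iff : ∀ i, i ∈ S ↔ p i ≠ 0 ∧ (∀ j ∈ S, rank i < rank j → I.bag j ≠ I.bag i) ∧
    ∀ k, I.bot i ≤ I.bot k → I.bot k < 2 * I.bot i →
      2 * (I.demand i + ∑ j ∈ S with rank i < rank j ∧ I.source j < I.target i ∧
        I.bot k < 2 * I.bot j ∧ I.bot j ≤ I.bot k, I.demand j) ≤ I.bot k

open Classical in
/-- The share of task `j` in the dual variables raised by task `i`. -/
noncomputable def share (rank : Fin I.n → ℕ) (i j : Fin I.n) : ℚ :=
  (if rank i ≤ rank j ∧ I.bag i = I.bag j then 1 else 0) +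
    (if rank i < rank j ∧ Sim i j ∧ I.source j < I.target i then
      4 * (I.demand j / I.bot j : ℚ) else 0)

theorem share_nonneg (rank : Fin I.n → ℕ) (i j : Fin I.n) : 0 ≤ share rank i j := by
  unfold share; positivity

namespace IsLocalRatio

variable {rank p : Fin I.n → ℕ} {S : Finset (Fin I.n)}

-- Clearing the denominator `bot i` turns the rational shares into the integer sums of `cover` and
-- `tight`.
open Classical in
theorem bot_mul_sum_share (i : Fin I.n) : (I.bot i : ℚ) * ∑ j, p j * share rank j i =
    ((I.bot i * (∑ j, if rank j ≤ rank i ∧ I.bag j = I.bag i then p j else 0) +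
      4 * I.demand i *
        ∑ j, if rank j < rank i ∧ Sim j i ∧ I.source i < I.target j then p j else 0 : ℕ) : ℚ) := by
  have hi0 : (I.bot i : ℚ) ≠ 0 := by exact_mod_cast (bot_pos i).ne'
  push_cast
  simp only [share, mul_add, Finset.sum_add_distrib, Finset.mul_sum]
  congr 1
  · refine Finset.sum_congr rfl fun j _ => ?_
    split_ifs <;> simp
  · refine Finset.sum_congr rfl fun j _ => ?_
    split_ifs
    · field_simp
    · simp

theorem five_le (h : IsLocalRatio rank p S) {i : Fin I.n} (hi : 4 * I.demand i ≤ I.bot i) :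
    5 ≤ ∑ j, p j * share rank j i := by
  have hi0 : (0 : ℚ) < I.bot i := by exact_mod_cast bot_pos i
  refine le_of_mul_le_mul_left ?_ hi0
  rw [bot_mul_sum_share, mul_comm]
  exact_mod_cast h.cover i hi

theorem le_six (h : IsLocalRatio rank p S) {i : Fin I.n} (hi : p i ≠ 0) :
    ∑ j, p j * share rank j i ≤ 6 := by
  have hi0 : (0 : ℚ) < I.bot i := by exact_mod_cast bot_pos i
  refine le_of_mul_le_mul_left ?_ hi0
  rw [bot_mul_sum_share, mul_comm (I.bot i : ℚ) 6]
  exact_mod_cast (h.tight i hi).le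

/-- On an edge, the tasks with bottleneck in `(c / 2, c]` use at most `c / 2`, and by induction
those with bottleneck at most `c / 2` use at most `c / 2` as well. -/
theorem feasible (h : IsLocalRatio rank p S) : I.Feasible S := by
  classical
  constructor
  · intro e
    have key : ∀ c, ∑ i ∈ S with I.Uses i e ∧ I.bot i ≤ c, I.demand i ≤ c := by
      intro c
      induction c using Nat.strong_induction_on with
      | _ c ih =>
        rcases Nat.eq_zero_or_pos c with rfl | hc
        · refine (Finset.sum_eq_zero fun i hi => ?_).le
          have := (Finset.mem_filter.1 hi).2.2
          have := bot_pos i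
          omega
        · have hrest := ih (c / 2) (by omega)
          set W := S.filter fun i => I.Uses i e ∧ I.bot i ≤ c ∧ c < 2 * I.bot i with hW
          -- The capacity test that matters is that of the task `i` of `W` selected last, for the
          -- window top given by the largest bottleneck in `W`; all other members of `W` were
          -- already selected and overlap `i`.
          have hwin : 2 * ∑ i ∈ W, I.demand i ≤ c := by
            rcases W.eq_empty_or_nonempty with h0 | hne
            · simp [h0]
            obtain ⟨i, hi, hmin⟩ := Finset.exists_min_image W rank hne
            obtain ⟨k, hk, hmax⟩ := Finset.exists_max_image W I.bot hne
            have hi' := Finset.mem_filter.1 hi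
            have hk' := Finset.mem_filter.1 hk
            have hb := ((h.mem_iff i).1 hi'.1).2.2 k (hmax i hi) (by omega)
            rw [← Finset.add_sum_erase _ _ hi]
            refine le_trans (Nat.mul_le_mul_left 2 (Nat.add_le_add_left
              (Finset.sum_le_sum_of_subset fun j hj => ?_) _)) (hb.trans hk'.2.2.1)
            have hj1 := Finset.mem_of_mem_erase hj
            have hj' := Finset.mem_filter.1 hj1
            have hov := overlap_of_uses hi'.2.1 hj'.2.1
            refine Finset.mem_filter.2 ⟨hj'.1, lt_of_le_of_ne (hmin j hj1) fun heq => ?_, hov.2,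
              by omega, hmax j hj1⟩
            exact Finset.ne_of_mem_erase hj (h.inj heq).symm
          have hsub : (S.filter fun i => I.Uses i e ∧ I.bot i ≤ c) ⊆
              W ∪ S.filter fun i => I.Uses i e ∧ I.bot i ≤ c / 2 := by
            intro i hi
            simp only [hW, Finset.mem_union, Finset.mem_filter] at *
            by_cases hc : c < 2 * I.bot i
            · tauto
            · exact Or.inr ⟨hi.1, hi.2.1, by omega⟩
          have h1 := Finset.sum_le_sum_of_subset (f := I.demand) hsub
          have h2 := Finset.sum_union_inter (f := I.demand) (s₁ := W)
            (s₂ := S.filter fun i => I.Uses i e ∧ I.bot i ≤ c / 2)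
          omega
    refine le_trans (Finset.sum_le_sum_of_subset fun i hi => ?_) (key (I.capacity e))
    rw [Finset.mem_filter] at *
    exact ⟨hi.1, hi.2, bot_le hi.2⟩
  · intro i hi j hj hb
    rcases lt_trichotomy (rank i) (rank j) with hr | hr | hr
    · exact absurd hb.symm (((h.mem_iff i).1 hi).2.1 j hj hr)
    · exact h.inj hr
    · exact absurd hb (((h.mem_iff j).1 hj).2.1 i hi hr)

/-- A raised task is selected, or blocked by its bag, or blocked by a window; in each case the
selected tasks collect a full unit of its share. -/
theorem one_le_sum_share (h : IsLocalRatio rank p S) {i : Fin I.n} (hi : p i ≠ 0) :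
    1 ≤ ∑ j ∈ S, share rank i j := by
  classical
  have hbag : ∀ j ∈ S, rank i ≤ rank j → I.bag i = I.bag j → 1 ≤ ∑ j ∈ S, share rank i j := by
    intro j hj hr hb
    refine le_trans ?_ (Finset.single_le_sum (fun j _ => share_nonneg rank i j) hj)
    rw [share, if_pos ⟨hr, hb⟩]
    exact le_add_of_nonneg_right (by positivity)
  by_cases hiS : i ∈ S
  · exact hbag i hiS le_rfl rfl
  have h1 := mt (h.mem_iff i).2 hiS
  rw [not_and, not_and_or] at h1
  rcases h1 hi with h2 | h2
  · push Not at h2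
    obtain ⟨j, hj, hr, hb⟩ := h2
    exact hbag j hj hr.le hb.symm
  · push Not at h2
    obtain ⟨k, hk1, hk2, hlt⟩ := h2
    set T := S.filter fun j => rank i < rank j ∧ I.source j < I.target i ∧
        I.bot k < 2 * I.bot j ∧ I.bot j ≤ I.bot k with hT
    have hs := h.small i hi
    have hk0 : (0 : ℚ) < I.bot k := by exact_mod_cast bot_pos k
    -- Since `i` is small, `2 * demand i ≤ bot k / 2`, so the blocking tasks supply demand at least
    -- `bot k / 4`; the factor 4 in `share` compensates for this.
    have hsum : I.bot k ≤ 4 * ∑ j ∈ T, I.demand j := by omega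
    have e1 : (1 : ℚ) ≤ ∑ j ∈ T, 4 * (I.demand j / I.bot k : ℚ) := by
      rw [← Finset.mul_sum, ← Finset.sum_div, ← mul_div_assoc, le_div_iff₀ hk0, one_mul]
      exact_mod_cast hsum
    refine e1.trans (le_trans (Finset.sum_le_sum fun j hj => ?_)
      (Finset.sum_le_sum_of_subset_of_nonneg (Finset.filter_subset _ _)
        fun j _ _ => share_nonneg rank i j))
    have hj' := (Finset.mem_filter.1 hj).2
    have hj0 : (0 : ℚ) < I.bot j := by exact_mod_cast bot_pos j
    have hle : (I.bot j : ℚ) ≤ I.bot k := by exact_mod_cast hj'.2.2.2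
    rw [share, if_pos (c := rank i < rank j ∧ _)
      ⟨hj'.1, ⟨by omega, by omega⟩, hj'.2.1⟩]
    refine le_trans ?_ (le_add_of_nonneg_left (by positivity))
    gcongr

/-- Double counting: each unit of raise deposits at least 1 in `S`, and each task of `S` receives at
most 6. -/
theorem sum_le_six_mul (h : IsLocalRatio rank p S) : ∑ i, p i ≤ 6 * S.card := by
  have h1 : (∑ i, (p i : ℚ)) ≤ ∑ i, p i * ∑ j ∈ S, share rank i j := by
    refine Finset.sum_le_sum fun i _ => ?_
    by_cases hi : p i = 0
    · simp [hi]
    · exact le_mul_of_one_le_right (Nat.cast_nonneg _) (h.one_le_sum_share hi)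
  have h2 : ∑ i, (p i : ℚ) * ∑ j ∈ S, share rank i j ≤ S.card * 6 := by
    simp only [Finset.mul_sum]
    rw [Finset.sum_comm, ← nsmul_eq_mul]
    exact Finset.sum_le_card_nsmul _ _ _ fun j hj => h.le_six ((h.mem_iff j).1 hj).1
  have h3 := h1.trans h2
  rw [mul_comm] at h3
  exact_mod_cast h3

/-- A unit raise of `i` deposits at most `25 = 1 + 2 * 4 * 3` in `O`: one task of its bag, and two
stacks on its last edge with `∑ d / b ≤ 3` each. Every task of `O` receives at least 5, so `5|O| ≤
25 ∑ p ≤ 150|S|`. -/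
theorem card_le (h : IsLocalRatio rank p S) {O : Finset (Fin I.n)} (hO : I.Feasible O)
    (hs : ∀ i ∈ O, 4 * I.demand i ≤ I.bot i) : O.card ≤ 30 * S.card := by
  classical
  have hw : ∀ i, ∑ o ∈ O, share rank i o ≤ 25 := by
    intro i
    have e1 : (∑ o ∈ O, if rank i ≤ rank o ∧ I.bag i = I.bag o then (1 : ℚ) else 0) ≤ 1 := by
      rw [Finset.sum_boole]
      have : (O.filter fun o => rank i ≤ rank o ∧ I.bag i = I.bag o).card ≤ 1 := by
        refine Finset.card_le_one.2 fun a ha b hb => ?_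
        rw [Finset.mem_filter] at ha hb
        exact hO.2 a ha.1 b hb.1 (ha.2.2.symm.trans hb.2.2)
      exact_mod_cast this
    have e2 : (∑ o ∈ O, if rank i < rank o ∧ Sim i o ∧ I.source o < I.target i then
        4 * (I.demand o / I.bot o : ℚ) else 0) ≤ 2 * (4 * 3) := by
      rw [← Finset.sum_filter]
      refine hO.sum_le_two_mul (Finset.filter_subset _ _) (e := I.lastEdge i) (fun o ho => ?_)
        (w := fun o => 4 * (I.demand o / I.bot o : ℚ)) (fun o => by positivity) fun U hU hst => ?_
      · have := (Finset.mem_filter.1 ho).2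
        exact uses_lastEdge this.2.2 (h.target_le _ _ this.1)
      · rw [← Finset.mul_sum]
        have := hst.sum_div_le (a := i) fun o ho => (Finset.mem_filter.1 (hU ho)).2.2.1
        linarith
    simp only [share, Finset.sum_add_distrib]
    linarith
  have h1 : (O.card : ℚ) * 5 ≤ ∑ o ∈ O, ∑ i, p i * share rank i o := by
    rw [← nsmul_eq_mul]
    exact Finset.card_nsmul_le_sum _ _ _ fun o ho => h.five_le (hs o ho)
  have h2 : ∑ o ∈ O, ∑ i, (p i : ℚ) * share rank i o ≤ ∑ i, (p i : ℚ) * 25 := by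
    rw [Finset.sum_comm]
    simp only [← Finset.mul_sum]
    exact Finset.sum_le_sum fun i _ => mul_le_mul_of_nonneg_left (hw i) (Nat.cast_nonneg _)
  have h3 := h1.trans h2
  rw [← Finset.sum_mul] at h3
  have h4 : O.card * 5 ≤ (∑ i, p i) * 25 := by exact_mod_cast h3
  have h5 := h.sum_le_six_mul
  omega

end IsLocalRatio

/-! ### The ratio -/

open Classical in
theorem opt_le_of_card_le (hI : I.Unweighted) {α : ℕ} {X : Finset (Fin I.n)}
    (h : ∀ O, I.Feasible O → O.card ≤ α * X.card) : I.opt ≤ α * I.totalWeight X := by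
  refine Finset.sup_le fun O hO => ?_
  have hO' := h O (Finset.mem_filter.1 hO).2
  obtain ⟨c, hc⟩ : ∃ c, ∀ i, I.weight i = c := by
    rcases isEmpty_or_nonempty (Fin I.n) with he | ⟨⟨i⟩⟩
    · exact ⟨0, fun i => he.elim i⟩
    · exact ⟨I.weight i, fun j => hI j i⟩
  simp only [totalWeight, hc, Finset.sum_const, smul_eq_mul]
  rw [← mul_assoc]
  exact Nat.mul_le_mul_right c hO'

theorem Feasible.card_le_of_parts {O S A B G : Finset (Fin I.n)} {rank p : Fin I.n → ℕ}
    (hO : I.Feasible O) (hS : IsLocalRatio rank p S)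
    (hA : IsGreedy (fun i => I.demand i ≤ I.bot i ∧ I.bot i < 2 * I.demand i)
      (fun i => I.bot i - I.demand i) I.bot A)
    (hB : IsGreedy (fun i => 2 * I.demand i ≤ I.bot i ∧ I.bot i < 4 * I.demand i)
      (fun i => I.bot i - I.demand i) I.target B)
    (hG : IsGreedy (fun i => I.demand i ≤ I.bot i) (fun _ => 0) I.target G) :
    O.card ≤ 30 * S.card + 17 * B.card + 17 * A.card + 5 * G.card := by
  classical
  have h1 := hS.card_le (O := O.filter fun i => 4 * I.demand i ≤ I.bot i)
    (hO.mono (Finset.filter_subset _ _)) fun i hi => (Finset.mem_filter.1 hi).2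
  have h2 := Feasible.card_le_of_medium
    (O := O.filter fun i => 2 * I.demand i ≤ I.bot i ∧ I.bot i < 4 * I.demand i)
    (hO.mono (Finset.filter_subset _ _)) (fun i hi => (Finset.mem_filter.1 hi).2) hB
  have h3 := Feasible.card_le_of_large (O := O.filter fun i => I.bot i < 2 * I.demand i)
    (hO.mono (Finset.filter_subset _ _)) (fun i hi => (Finset.mem_filter.1 hi).2) hA hG
  have hcov : O ⊆ (O.filter fun i => 4 * I.demand i ≤ I.bot i) ∪
      (O.filter fun i => 2 * I.demand i ≤ I.bot i ∧ I.bot i < 4 * I.demand i) ∪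
      (O.filter fun i => I.bot i < 2 * I.demand i) := by
    intro i hi
    simp only [Finset.mem_union, Finset.mem_filter, hi, true_and]
    omega
  have h4 := Finset.card_le_card hcov
  have h5 := (h4.trans (Finset.card_union_le _ _)).trans
    (Nat.add_le_add_right (Finset.card_union_le _ _) _)
  omega

end BagUFP

namespace RAM

/-! ### Loop programs of polynomial cost -/

/-- Loop programs; `loop x y p` runs `p` with `reg x = 0, …, reg y - 1`. -/
inductive Code where
  | skip
  | assign (x : ℕ) (e : Expr)
  | store (a : ℕ) (idx e : Expr)
  | seq (p q : Code)
  | ite (e : Expr) (p q : Code)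
  | loop (x y : ℕ) (p : Code)

/-- The state after `k` rounds of a loop with body `f` and counter `x`. -/
def iter (f : State → State) (x : ℕ) (σ : State) : ℕ → State
  | 0 => σ.setReg x 0
  | k + 1 => (f (iter f x σ k)).setReg x (k + 1)

namespace Code

/-- The program of the machine. -/
def toProg : Code → Prog
  | skip => .skip
  | assign x e => .assign x e
  | store a idx e => .store a idx e
  | seq p q => .seq p.toProg q.toProg
  | ite e p q => .ite e p.toProg q.toProg
  | loop x y p => .seq (.assign x (.const 0)) (.while (.sub (.var y) (.var x))
      (.seq p.toProg (.assign x (.add (.var x) (.const 1)))))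

/-- The final state of a loop program. -/
def run : Code → State → State
  | skip, σ => σ
  | assign x e, σ => σ.setReg x (e.eval σ)
  | store a idx e, σ => σ.setMem a (idx.eval σ) (e.eval σ)
  | seq p q, σ => q.run (p.run σ)
  | ite e p q, σ => if e.eval σ ≠ 0 then p.run σ else q.run σ
  | loop x y p, σ => iter p.run x σ (σ.reg y)

/-- Register `z` is assigned in the program. -/
def writes (z : ℕ) : Code → Bool
  | skip => false
  | assign x _ => x == z
  | store _ _ _ => false
  | seq p q => p.writes z || q.writes z
  | ite _ p q => p.writes z || q.writes z
  | loop x _ p => x == z || p.writes z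

/-- Array `b` is modified in the program. -/
def stores (b : ℕ) : Code → Bool
  | skip => false
  | assign _ _ => false
  | store a _ _ => a == b
  | seq p q => p.stores b || q.stores b
  | ite _ p q => p.stores b || q.stores b
  | loop _ _ p => p.stores b

end Code

/-- The value of the expression does not involve products. -/
def Expr.linear : Expr → Bool
  | const _ => true
  | var _ => true
  | arr _ _ => true
  | add e₁ e₂ => e₁.linear && e₂.linear
  | sub e₁ e₂ => e₁.linear && e₂.linear
  | mul _ _ => false

namespace Code

/-- Loops are bounded by the registers `0` and `1`, which do not change, loop counters are modified
only by their loops, and only values of linear expressions are stored. -/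
def Wf : Code → Bool
  | skip => true
  | assign x e => x != 0 && x != 1 && e.linear
  | store _ _ e => e.linear
  | seq p q => p.Wf && q.Wf
  | ite _ p q => p.Wf && q.Wf
  | loop x y p => x != 0 && x != 1 && (y == 0 || y == 1) && !p.writes x && p.Wf

end Code

/-! ### Frame conditions, bit lengths and costs of loop programs. -/

@[simp] theorem State.setReg_reg_self (σ : State) (x v : ℕ) : (σ.setReg x v).reg x = v := by
  simp [State.setReg]

theorem State.setReg_reg_of_ne (σ : State) {x y : ℕ} (v : ℕ) (h : y ≠ x) :
    (σ.setReg x v).reg y = σ.reg y := by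
  simp [State.setReg, h]

@[simp] theorem State.setReg_mem (σ : State) (x v : ℕ) : (σ.setReg x v).mem = σ.mem := rfl

theorem Code.run_reg {z : ℕ} (p : Code) (h : p.writes z = false) (σ : State) :
    (p.run σ).reg z = σ.reg z := by
  induction p generalizing σ with
  | skip => rfl
  | assign x e =>
    simp only [writes, beq_eq_false_iff_ne] at h
    exact State.setReg_reg_of_ne _ _ h.symm
  | store a idx e => rfl
  | seq p q hp hq =>
    simp only [writes, Bool.or_eq_false_iff] at h
    rw [run, hq h.2, hp h.1]
  | ite e p q hp hq =>
    simp only [writes, Bool.or_eq_false_iff] at h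
    rw [run]
    split_ifs
    · exact hp h.1 _
    · exact hq h.2 _
  | loop x y p hp =>
    simp only [writes, Bool.or_eq_false_iff, beq_eq_false_iff_ne] at h
    rw [run]
    induction σ.reg y with
    | zero => exact State.setReg_reg_of_ne _ _ h.1.symm
    | succ k ih => rw [iter, State.setReg_reg_of_ne _ _ h.1.symm, hp h.2, ih]

theorem Code.run_mem {b : ℕ} (p : Code) (h : p.stores b = false) (σ : State) :
    (p.run σ).mem b = σ.mem b := by
  induction p generalizing σ with
  | skip => rfl
  | assign x e => rfl
  | store a idx e =>
    simp only [stores, beq_eq_false_iff_ne] at h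
    simp [run, State.setMem, h.symm]
  | seq p q hp hq =>
    simp only [stores, Bool.or_eq_false_iff] at h
    rw [run, hq h.2, hp h.1]
  | ite e p q hp hq =>
    simp only [stores, Bool.or_eq_false_iff] at h
    rw [run]
    split_ifs
    · exact hp h.1 _
    · exact hq h.2 _
  | loop x y p hp =>
    rw [run]
    induction σ.reg y with
    | zero => rfl
    | succ k ih => rw [iter, State.setReg_mem, hp h, ih]

theorem Code.Wf.writes_eq_false {p : Code} (h : p.Wf) {z : ℕ} (hz : z = 0 ∨ z = 1) :
    p.writes z = false := by
  induction p with
  | skip => rfl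
  | assign x e => simp [Wf] at h; simp [writes]; omega
  | store a idx e => rfl
  | seq p q hp hq => simp only [Wf, Bool.and_eq_true] at h; simp [writes, hp h.1, hq h.2]
  | ite e p q hp hq => simp only [Wf, Bool.and_eq_true] at h; simp [writes, hp h.1, hq h.2]
  | loop x y p hp => simp [Wf] at h; simp [writes, hp h.2]; omega

/-- All numbers in the memory have at most `B` bits. -/
def State.Bounded (σ : State) (B : ℕ) : Prop :=
  (∀ x, Nat.size (σ.reg x) ≤ B) ∧ ∀ a i, Nat.size (σ.mem a i) ≤ B

theorem State.Bounded.mono {σ : State} {B B' : ℕ} (h : σ.Bounded B) (hB : B ≤ B') :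
    σ.Bounded B' :=
  ⟨fun x => (h.1 x).trans hB, fun a i => (h.2 a i).trans hB⟩

theorem State.Bounded.setReg {σ : State} {B : ℕ} (h : σ.Bounded B) {x v : ℕ}
    (hv : Nat.size v ≤ B) : (σ.setReg x v).Bounded B := by
  refine ⟨fun y => ?_, h.2⟩
  rcases eq_or_ne y x with rfl | hy
  · simpa using hv
  · rw [State.setReg_reg_of_ne _ _ hy]; exact h.1 y

theorem State.Bounded.setMem {σ : State} {B : ℕ} (h : σ.Bounded B) {a i v : ℕ}
    (hv : Nat.size v ≤ B) : (σ.setMem a i v).Bounded B := by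
  refine ⟨h.1, fun b j => ?_⟩
  rcases eq_or_ne b a with rfl | hb
  · rcases eq_or_ne j i with rfl | hj
    · simpa [State.setMem] using hv
    · simpa [State.setMem, hj] using h.2 b j
  · simpa [State.setMem, hb] using h.2 b j

theorem size_add_le (a b : ℕ) : Nat.size (a + b) ≤ max (Nat.size a) (Nat.size b) + 1 := by
  rw [Nat.size_le, pow_succ]
  have h1 : a < 2 ^ max (Nat.size a) (Nat.size b) := Nat.size_le.1 (le_max_left _ _)
  have h2 : b < 2 ^ max (Nat.size a) (Nat.size b) := Nat.size_le.1 (le_max_right _ _)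
  omega

theorem size_mul_le (a b : ℕ) : Nat.size (a * b) ≤ Nat.size a + Nat.size b := by
  rw [Nat.size_le, pow_add]
  exact Nat.mul_lt_mul'' (Nat.size_le.1 le_rfl) (Nat.size_le.1 le_rfl)

/-- The growth is an additive constant independent of `B`. A product could double the bit length,
and repeated in a loop this would be exponential; products are therefore confined to tests and
addresses. -/
theorem Expr.exists_size_le_add {e : Expr} (he : e.linear) :
    ∃ K, ∀ (σ : State) (B : ℕ), σ.Bounded B → Nat.size (e.eval σ) ≤ B + K := by
  induction e with
  | const c => exact ⟨Nat.size c, fun σ B _ => Nat.le_add_left _ _⟩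
  | var x => exact ⟨0, fun σ B h => h.1 x⟩
  | arr a e => exact ⟨0, fun σ B h => h.2 a _⟩
  | add e₁ e₂ h₁ h₂ =>
    simp only [linear, Bool.and_eq_true] at he
    obtain ⟨K₁, h₁⟩ := h₁ he.1
    obtain ⟨K₂, h₂⟩ := h₂ he.2
    refine ⟨K₁ + K₂ + 1, fun σ B h => (size_add_le _ _).trans ?_⟩
    have := h₁ σ B h
    have := h₂ σ B h
    omega
  | sub e₁ e₂ h₁ h₂ =>
    simp only [linear, Bool.and_eq_true] at he
    obtain ⟨K₁, h₁⟩ := h₁ he.1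
    exact ⟨K₁, fun σ B h => (Nat.size_le_size (Nat.sub_le _ _)).trans (h₁ σ B h)⟩
  | mul e₁ e₂ => simp [linear] at he

theorem Expr.exists_cost_le (e : Expr) :
    ∃ K, ∀ (σ : State) (B : ℕ), σ.Bounded B →
      Nat.size (e.eval σ) ≤ K * (B + 1) ∧ e.cost σ ≤ K * (B + 1) := by
  induction e with
  | const c =>
    exact ⟨1 + Nat.size c, fun σ B _ => ⟨by simp only [eval]; nlinarith [Nat.zero_le (Nat.size c)],
      Nat.le_mul_of_pos_right _ (by omega)⟩⟩
  | var x =>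
    refine ⟨1, fun σ B h => ?_⟩
    have := h.1 x
    simp only [eval, cost]; omega
  | arr a e he =>
    obtain ⟨K, hK⟩ := he
    refine ⟨2 * K + 2, fun σ B h => ?_⟩
    have := hK σ B h
    have := h.2 a (e.eval σ)
    simp only [eval, cost, add_mul, mul_assoc]; omega
  | add e₁ e₂ h₁ h₂ =>
    obtain ⟨K₁, h₁⟩ := h₁
    obtain ⟨K₂, h₂⟩ := h₂
    refine ⟨2 * K₁ + 2 * K₂ + 1, fun σ B h => ?_⟩
    have := h₁ σ B h
    have := h₂ σ B h
    have := size_add_le (e₁.eval σ) (e₂.eval σ)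
    simp only [eval, cost, add_mul, mul_assoc]; omega
  | sub e₁ e₂ h₁ h₂ =>
    obtain ⟨K₁, h₁⟩ := h₁
    obtain ⟨K₂, h₂⟩ := h₂
    refine ⟨2 * K₁ + 2 * K₂ + 1, fun σ B h => ?_⟩
    have := h₁ σ B h
    have := h₂ σ B h
    have := Nat.size_le_size (Nat.sub_le (e₁.eval σ) (e₂.eval σ))
    simp only [eval, cost, add_mul, mul_assoc]; omega
  | mul e₁ e₂ h₁ h₂ =>
    obtain ⟨K₁, h₁⟩ := h₁
    obtain ⟨K₂, h₂⟩ := h₂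
    refine ⟨2 * K₁ + 2 * K₂ + 1, fun σ B h => ?_⟩
    have := h₁ σ B h
    have := h₂ σ B h
    have := size_mul_le (e₁.eval σ) (e₂.eval σ)
    simp only [eval, cost, add_mul, mul_assoc]; omega

theorem eval_mono (p : Polynomial ℕ) {a b : ℕ} (h : a ≤ b) : p.eval a ≤ p.eval b := by
  simp only [Polynomial.eval_eq_sum_range]
  gcongr

theorem iter_reg (f : State → State) (x : ℕ) (σ : State) (k : ℕ) : (iter f x σ k).reg x = k := by
  cases k <;> simp [iter]

/-- The cost of a loop whose rounds have bounded cost. -/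
theorem exec_loop {p : Code} {x y N D B : ℕ} {σ : State} (hN : σ.reg y = N)
    (hy : ∀ k ≤ N, (iter p.run x σ k).reg y = N) (hB : ∀ k ≤ N, (iter p.run x σ k).Bounded B)
    (hx : p.writes x = false)
    (hp : ∀ k < N, ∃ c, Exec p.toProg (iter p.run x σ k) (p.run (iter p.run x σ k)) c ∧ c ≤ D) :
    ∃ c, Exec (Code.loop x y p).toProg σ ((Code.loop x y p).run σ) c ∧
      c ≤ 2 + (N + 1) * (D + 7 * B + 10) := by
  have htest : ∀ k ≤ N, (Expr.sub (.var y) (.var x)).cost (iter p.run x σ k) ≤ 4 * B + 3 := by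
    intro k hk
    have := (hB k hk).1 x
    have := (hB k hk).1 y
    simp only [Expr.cost, Expr.eval]; omega
  have hloop : ∀ j k, k + j = N → ∃ c, Exec (.while (.sub (.var y) (.var x))
      (.seq p.toProg (.assign x (.add (.var x) (.const 1))))) (iter p.run x σ k)
      (iter p.run x σ N) c ∧ c ≤ j * (D + 7 * B + 10) + (4 * B + 4) := by
    intro j
    induction j with
    | zero =>
      rintro k rfl
      refine ⟨_, Exec.while_false ?_, ?_⟩
      · simp [Expr.eval, iter_reg, hy]
      · have := htest k le_rfl
        omega
    | succ j ih =>
      intro k hk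
      obtain ⟨c₁, h₁, hc₁⟩ := hp k (by omega)
      obtain ⟨c₂, h₂, hc₂⟩ := ih (k + 1) (by omega)
      have hreg : (p.run (iter p.run x σ k)).reg x = k := by rw [p.run_reg hx, iter_reg]
      have hinc := Exec.assign (p.run (iter p.run x σ k)) x (.add (.var x) (.const 1))
      rw [show (Expr.add (.var x) (.const 1)).eval (p.run (iter p.run x σ k)) = k + 1 by
        simp [Expr.eval, hreg]] at hinc
      refine ⟨_, Exec.while_true ?_ (Exec.seq h₁ hinc) h₂, ?_⟩
      · simp only [Expr.eval, iter_reg, hy k (by omega)]; omega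
      -- The overhead `7 * B + 10` of a round is `4 * B + 4` for the test and `3 * B + 6` for the
      -- increment.
      · have e1 := htest k (by omega)
        have e2 : Nat.size (k + 1) ≤ B := by
          simpa [iter_reg] using (hB (k + 1) (by omega)).1 x
        have e3 : Nat.size k ≤ B := by simpa [iter_reg] using (hB k (by omega)).1 x
        have e4 : (Expr.add (.var x) (.const 1)).cost (p.run (iter p.run x σ k)) ≤
            2 * B + 5 := by
          simp only [Expr.cost, Expr.eval, hreg, Nat.size_one]; omega
        rw [add_mul, one_mul]
        omega
  obtain ⟨c, h, hc⟩ := hloop N 0 (by omega)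
  have hrun : (Code.loop x y p).run σ = iter p.run x σ N := by rw [Code.run, hN]
  rw [hrun]
  refine ⟨_, Exec.seq (Exec.assign σ x (.const 0)) h, ?_⟩
  simp only [Expr.cost, Expr.eval, Nat.size_zero, add_mul, one_mul]
  omega

/-- Well-formed loop programs run in polynomial time. -/
theorem Code.exists_polynomial_bound (p : Code) (hp : p.Wf) :
    ∃ G C : Polynomial ℕ, ∀ (N B : ℕ) (σ : State), σ.reg 0 ≤ N → σ.reg 1 ≤ N → σ.Bounded B →
      ∃ c, Exec p.toProg σ (p.run σ) c ∧ c ≤ C.eval (N + B) ∧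
        (p.run σ).Bounded (B + G.eval N) := by
  -- The bit growth `G` depends on `N` alone, not on `B`, so that `N` rounds of a loop add only `N *
  -- G(N)` bits.
  induction p with
  | skip =>
    exact ⟨0, 1, fun N B σ _ _ hB => ⟨1, Exec.skip σ, by simp, by simpa [run] using hB⟩⟩
  | assign x e =>
    simp only [Wf, Bool.and_eq_true] at hp
    obtain ⟨K, hK⟩ := Expr.exists_size_le_add hp.2
    obtain ⟨K', hK'⟩ := e.exists_cost_le
    refine ⟨.C K, .C (2 * K') * (.X + 1) + 1, fun N B σ _ _ hB =>
      ⟨_, Exec.assign σ x e, ?_, ?_⟩⟩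
    · have := hK' σ B hB
      simp only [Polynomial.eval_add, Polynomial.eval_mul, Polynomial.eval_C, Polynomial.eval_X,
        Polynomial.eval_one]
      nlinarith [Nat.zero_le (K' * N)]
    · rw [Polynomial.eval_C]
      exact (hB.mono (Nat.le_add_right _ _)).setReg (hK σ B hB)
  | store a idx e =>
    obtain ⟨K, hK⟩ := Expr.exists_size_le_add hp
    obtain ⟨K', hK'⟩ := e.exists_cost_le
    obtain ⟨K'', hK''⟩ := idx.exists_cost_le
    refine ⟨.C K, .C (2 * K' + 2 * K'') * (.X + 1) + 1, fun N B σ _ _ hB =>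
      ⟨_, Exec.store σ a idx e, ?_, ?_⟩⟩
    · have := hK' σ B hB
      have := hK'' σ B hB
      simp only [Polynomial.eval_add, Polynomial.eval_mul, Polynomial.eval_C, Polynomial.eval_X,
        Polynomial.eval_one]
      nlinarith [Nat.zero_le (K' * N), Nat.zero_le (K'' * N)]
    · rw [Polynomial.eval_C]
      exact (hB.mono (Nat.le_add_right _ _)).setMem (hK σ B hB)
  | seq p q ihp ihq =>
    simp only [Wf, Bool.and_eq_true] at hp
    obtain ⟨G₁, C₁, h₁⟩ := ihp hp.1
    obtain ⟨G₂, C₂, h₂⟩ := ihq hp.2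
    refine ⟨G₁ + G₂, C₁ + C₂.comp (.X + G₁), fun N B σ h0 h1 hB => ?_⟩
    obtain ⟨c₁, e₁, hc₁, hB₁⟩ := h₁ N B σ h0 h1 hB
    obtain ⟨c₂, e₂, hc₂, hB₂⟩ := h₂ N _ (p.run σ)
      (by rwa [p.run_reg (Wf.writes_eq_false hp.1 (Or.inl rfl))])
      (by rwa [p.run_reg (Wf.writes_eq_false hp.1 (Or.inr rfl))]) hB₁
    refine ⟨_, Exec.seq e₁ e₂, ?_, ?_⟩
    · simp only [Polynomial.eval_add, Polynomial.eval_comp, Polynomial.eval_X]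
      refine Nat.add_le_add hc₁ (hc₂.trans (eval_mono _ ?_))
      have := eval_mono G₁ (Nat.le_add_right N B)
      omega
    · rw [Polynomial.eval_add, ← add_assoc]; exact hB₂
  | ite e p q ihp ihq =>
    simp only [Wf, Bool.and_eq_true] at hp
    obtain ⟨G₁, C₁, h₁⟩ := ihp hp.1
    obtain ⟨G₂, C₂, h₂⟩ := ihq hp.2
    obtain ⟨K, hK⟩ := e.exists_cost_le
    refine ⟨G₁ + G₂, .C K * (.X + 1) + 1 + (C₁ + C₂), fun N B σ h0 h1 hB => ?_⟩
    obtain ⟨c₁, e₁, hc₁, hB₁⟩ := h₁ N B σ h0 h1 hB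
    obtain ⟨c₂, e₂, hc₂, hB₂⟩ := h₂ N B σ h0 h1 hB
    have hcost : e.cost σ ≤ K * (N + B + 1) :=
      (hK σ B hB).2.trans (Nat.mul_le_mul_left _ (by omega))
    simp only [Polynomial.eval_add, Polynomial.eval_mul, Polynomial.eval_C, Polynomial.eval_X,
      Polynomial.eval_one, run]
    split_ifs with h
    · exact ⟨_, Exec.ite_true h e₁, by omega, hB₁.mono (by omega)⟩
    · exact ⟨_, Exec.ite_false (not_not.1 h) e₂, by omega, hB₂.mono (by omega)⟩
  | loop x y p ih =>
    simp only [Wf, Bool.and_eq_true, Bool.or_eq_true, bne_iff_ne, beq_iff_eq,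
      Bool.not_eq_true'] at hp
    obtain ⟨⟨⟨⟨hx0, hx1⟩, hy⟩, hx⟩, hwf⟩ := hp
    obtain ⟨G, C, h⟩ := ih hwf
    refine ⟨.X * G, 2 + (.X + 1) * (C.comp (.X + .X * G) + 7 * (.X + .X * G) + 10),
      fun N B σ h0 h1 hB => ?_⟩
    have hfix : ∀ z, z = 0 ∨ z = 1 → ∀ k, (iter p.run x σ k).reg z = σ.reg z := by
      intro z hz k
      have hzx : z ≠ x := by omega
      induction k with
      | zero => exact State.setReg_reg_of_ne _ _ hzx
      | succ k ihk =>
        rw [iter, State.setReg_reg_of_ne _ _ hzx, p.run_reg (Wf.writes_eq_false hwf hz), ihk]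
    have hyN : σ.reg y ≤ N := by rcases hy with rfl | rfl <;> assumption
    have hbd : ∀ k ≤ σ.reg y, (iter p.run x σ k).Bounded (B + k * G.eval N) := by
      intro k hk
      induction k with
      | zero => exact (hB.setReg (by simp)).mono (by omega)
      | succ k ihk =>
        obtain ⟨c, -, -, hb⟩ := h N _ (iter p.run x σ k) (by rwa [hfix 0 (Or.inl rfl)])
          (by rwa [hfix 1 (Or.inr rfl)]) (ihk (by omega))
        rw [add_mul, one_mul, ← add_assoc]
        -- The counter never exceeds `reg y`, so its bit length is already within `B`.
        refine hb.setReg (le_trans (Nat.size_le_size hk) ((hB.1 y).trans ?_))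
        omega
    have hbd' : ∀ k ≤ σ.reg y, (iter p.run x σ k).Bounded (B + N * G.eval N) := fun k hk =>
      (hbd k hk).mono (Nat.add_le_add_left (Nat.mul_le_mul_right _ (hk.trans hyN)) _)
    obtain ⟨c, he, hc⟩ := exec_loop (D := C.eval (N + (B + N * G.eval N))) (p := p) (x := x)
      (y := y) (σ := σ) rfl (fun k _ => hfix y hy k) hbd' hx fun k hk => by
        obtain ⟨c, he, hc, -⟩ := h N _ (iter p.run x σ k) (by rwa [hfix 0 (Or.inl rfl)])
          (by rwa [hfix 1 (Or.inr rfl)]) (hbd' k hk.le)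
        exact ⟨c, he, hc⟩
    refine ⟨c, he, hc.trans ?_, ?_⟩
    · have hG := eval_mono G (Nat.le_add_right N B)
      have hNG : N * G.eval N ≤ (N + B) * G.eval (N + B) :=
        Nat.mul_le_mul (Nat.le_add_right _ _) hG
      have hC : C.eval (N + (B + N * G.eval N)) ≤
          C.eval ((N + B) + (N + B) * G.eval (N + B)) := eval_mono C (by omega)
      simp only [Polynomial.eval_add, Polynomial.eval_mul, Polynomial.eval_comp,
        Polynomial.eval_X, Polynomial.eval_one, Polynomial.eval_ofNat]
      refine Nat.add_le_add_left (Nat.mul_le_mul (by omega) (by omega)) _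
    · simp only [Polynomial.eval_mul, Polynomial.eval_X]
      exact hbd' _ le_rfl

end RAM

namespace RAM

/-! ### Tests, sums and scans -/

namespace Expr

/-- Truth of an expression used as a test. -/
def Holds (σ : State) (e : Expr) : Prop := e.eval σ ≠ 0

instance (σ : State) (e : Expr) : Decidable (e.Holds σ) := inferInstanceAs (Decidable (_ ≠ _))

/-- Strict comparison. -/
abbrev lt (a b : Expr) : Expr := sub b a

/-- Negation. -/
def not (a : Expr) : Expr := sub (const 1) a

/-- Conjunction. -/
def and (a b : Expr) : Expr := mul a b

/-- Disjunction. -/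
def or (a b : Expr) : Expr := add a b

/-- Weak comparison. -/
def le (a b : Expr) : Expr := not (lt b a)

/-- Equality. -/
def eq (a b : Expr) : Expr := and (le a b) (le b a)

/-- The double of an expression. -/
def two (a : Expr) : Expr := add a a

variable (σ : State) (a b : Expr)

@[simp] theorem holds_lt : (lt a b).Holds σ ↔ a.eval σ < b.eval σ := by
  simp only [Holds, eval]; omega

@[simp] theorem holds_not : (not a).Holds σ ↔ ¬ a.Holds σ := by
  simp only [Holds, not, eval]; omega

@[simp] theorem holds_and : (and a b).Holds σ ↔ a.Holds σ ∧ b.Holds σ := by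
  simp [Holds, and, eval]

@[simp] theorem holds_or : (or a b).Holds σ ↔ a.Holds σ ∨ b.Holds σ := by
  simp only [Holds, or, eval]; omega

@[simp] theorem holds_le : (le a b).Holds σ ↔ a.eval σ ≤ b.eval σ := by
  simp [le]

@[simp] theorem holds_eq : (eq a b).Holds σ ↔ a.eval σ = b.eval σ := by
  simp [eq, le_antisymm_iff]

@[simp] theorem holds_arr (c : ℕ) : (arr c a).Holds σ ↔ σ.mem c (a.eval σ) ≠ 0 := Iff.rfl

@[simp] theorem eval_two : (two a).eval σ = 2 * a.eval σ := by
  simp only [two, eval]; omega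

/-- The expression reads register `x`. -/
def reads (x : ℕ) : Expr → Bool
  | const _ => false
  | var y => y == x
  | arr _ e => e.reads x
  | add e₁ e₂ => e₁.reads x || e₂.reads x
  | sub e₁ e₂ => e₁.reads x || e₂.reads x
  | mul e₁ e₂ => e₁.reads x || e₂.reads x

theorem eval_congr {x : ℕ} {e : Expr} (h : e.reads x = false) {σ τ : State}
    (hr : ∀ y, y ≠ x → σ.reg y = τ.reg y) (hm : σ.mem = τ.mem) : e.eval σ = e.eval τ := by
  induction e with
  | const c => rfl
  | var y => exact hr y (by simpa [reads] using h)
  | arr a e he => rw [eval, eval, he h, hm]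
  | add e₁ e₂ h₁ h₂ =>
    simp only [reads, Bool.or_eq_false_iff] at h; rw [eval, eval, h₁ h.1, h₂ h.2]
  | sub e₁ e₂ h₁ h₂ =>
    simp only [reads, Bool.or_eq_false_iff] at h; rw [eval, eval, h₁ h.1, h₂ h.2]
  | mul e₁ e₂ h₁ h₂ =>
    simp only [reads, Bool.or_eq_false_iff] at h; rw [eval, eval, h₁ h.1, h₂ h.2]

end Expr

theorem State.setReg_reg (σ : State) (x v y : ℕ) :
    (σ.setReg x v).reg y = if y = x then v else σ.reg y := by
  simp [State.setReg, Function.update_apply]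

namespace Code

theorem run_seq (p q : Code) (σ : State) : (seq p q).run σ = q.run (p.run σ) := rfl

theorem run_ite (e : Expr) (p q : Code) (σ : State) :
    (ite e p q).run σ = if e.Holds σ then p.run σ else q.run σ := by
  by_cases h : e.eval σ = 0 <;> simp [run, Expr.Holds, h]

/-- The invariant rule for loops. -/
theorem run_loop {p : Code} {x y : ℕ} {σ : State}
    (Inv : ℕ → State → Prop) (h0 : Inv 0 (σ.setReg x 0))
    (hs : ∀ k < σ.reg y, ∀ τ : State, τ.reg x = k →
      (∀ z, z ≠ x → p.writes z = false → τ.reg z = σ.reg z) →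
      (∀ a, p.stores a = false → τ.mem a = σ.mem a) → Inv k τ →
      Inv (k + 1) ((p.run τ).setReg x (k + 1))) :
    Inv (σ.reg y) ((loop x y p).run σ) := by
  have key : ∀ k ≤ σ.reg y, Inv k (iter p.run x σ k) ∧
      (∀ z, z ≠ x → p.writes z = false → (iter p.run x σ k).reg z = σ.reg z) ∧
      (∀ a, p.stores a = false → (iter p.run x σ k).mem a = σ.mem a) := by
    intro k hk
    induction k with
    | zero => exact ⟨h0, fun z hz _ => State.setReg_reg_of_ne _ _ hz, fun a _ => rfl⟩
    | succ k ih =>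
      obtain ⟨h1, h2, h3⟩ := ih (by omega)
      refine ⟨hs k (by omega) _ (iter_reg _ _ _ _) h2 h3 h1, fun z hz hw => ?_, fun a ha => ?_⟩
      · rw [iter, State.setReg_reg_of_ne _ _ hz, p.run_reg hw, h2 z hz hw]
      · rw [iter, State.setReg_mem, p.run_mem ha, h3 a ha]
  exact (key _ le_rfl).1

/-- `reg acc := ∑ j < reg y, if c then v else 0`. -/
def sumLoop (acc j y : ℕ) (c v : Expr) : Code :=
  seq (assign acc (.const 0)) (loop j y (ite c (assign acc (.add (.var acc) v)) skip))

theorem run_sumLoop {acc j y : ℕ} {c v : Expr} (haj : acc ≠ j) (hay : y ≠ acc)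
    (hc : c.reads acc = false) (hv : v.reads acc = false) (σ : State) :
    ((sumLoop acc j y c v).run σ).reg acc = ∑ k ∈ Finset.range (σ.reg y),
      if c.Holds (σ.setReg j k) then v.eval (σ.setReg j k) else 0 := by
  rw [sumLoop, run, run]
  have hy : (σ.setReg acc ((Expr.const 0).eval σ)).reg y = σ.reg y :=
    State.setReg_reg_of_ne _ _ hay
  rw [← hy]
  refine run_loop (fun k τ => τ.reg acc =
    ∑ k ∈ Finset.range k, if c.Holds (σ.setReg j k) then v.eval (σ.setReg j k) else 0) ?_ ?_
  · simp [State.setReg_reg, haj, Expr.eval]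
  · intro k hk τ hj hreg hmem hacc
    have hm : τ.mem = (σ.setReg j k).mem := funext fun a => hmem a rfl
    have hr : ∀ z, z ≠ acc → τ.reg z = (σ.setReg j k).reg z := by
      intro z hz
      rcases eq_or_ne z j with rfl | hzj
      · simp [hj]
      · rw [hreg z hzj (by simp [writes, hz.symm]), State.setReg_reg_of_ne _ _ hz,
          State.setReg_reg_of_ne _ _ hzj]
    have h1 : c.Holds τ ↔ c.Holds (σ.setReg j k) := by
      rw [Expr.Holds, Expr.Holds, Expr.eval_congr hc hr hm]
    have h2 := Expr.eval_congr hv hr hm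
    rw [Finset.sum_range_succ, State.setReg_reg_of_ne _ _ haj, run_ite]
    by_cases h : c.Holds (σ.setReg j k)
    · simp [h1.2 h, h, run, hacc, h2, Expr.eval]
    · simp [mt h1.1 h, h, run, hacc]

/-- For all `r < n` and `i < n`, in this order, run `body` with `reg 3 = i` if `i` is preceded by
exactly `r` numbers below `n`. -/
def scan (before : Expr) (body : Code) : Code :=
  loop 2 1 (loop 3 1 (seq (sumLoop 6 4 1 before (.const 1))
    (ite (.eq (.var 6) (.var 2)) body skip)))

end Code

/-- Counting predecessors embeds a strict total order into the naturals; this replaces sorting in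
the scans and supplies `rank` in the local ratio method. -/
theorem card_filter_lt_iff {n : ℕ} {lt : ℕ → ℕ → Prop} [DecidableRel lt]
    (htr : ∀ i j k, lt i j → lt j k → lt i k) (hirr : ∀ i, ¬ lt i i)
    (htot : ∀ i j, i ≠ j → lt i j ∨ lt j i) {i j : ℕ} (hi : i < n) (hj : j < n) :
    ((Finset.range n).filter fun k => lt k i).card < ((Finset.range n).filter fun k => lt k j).card ↔
      lt i j := by
  have key : ∀ i j, i < n → lt i j → ((Finset.range n).filter fun k => lt k i).card <
      ((Finset.range n).filter fun k => lt k j).card := by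
    intro i j hi h
    refine Finset.card_lt_card (Finset.ssubset_iff_of_subset (fun k hk => ?_) |>.2 ⟨i, ?_, ?_⟩)
    · rw [Finset.mem_filter] at *
      exact ⟨hk.1, htr _ _ _ hk.2 h⟩
    · simp [hi, h]
    · simp [hirr]
  refine ⟨fun h => ?_, key i j hi⟩
  by_contra hcon
  rcases eq_or_ne i j with rfl | hne
  · exact lt_irrefl _ h
  · exact lt_asymm h (key j i hj ((htot i j hne).resolve_left hcon))

/-- A scan is described by its fixed-point equation: each final entry is `F` applied to the final
entries of its predecessors, all others read as zero. This holds because each entry is written at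
most once and unvisited entries are still zero. -/
theorem Code.run_scan {before : Expr} {body : Code} {A n : ℕ} {σ : State} (lt : ℕ → ℕ → Prop)
    [DecidableRel lt] (F : ℕ → (ℕ → ℕ) → ℕ) (hn : σ.reg 1 = n) (hA : ∀ i, σ.mem A i = 0)
    (htr : ∀ i j k, lt i j → lt j k → lt i k) (hirr : ∀ i, ¬ lt i i)
    (htot : ∀ i j, i ≠ j → lt i j ∨ lt j i)
    (hw1 : body.writes 1 = false) (hw2 : body.writes 2 = false) (hw3 : body.writes 3 = false)
    (hst : ∀ a, a ≠ A → body.stores a = false) (hr : before.reads 6 = false)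
    (hbefore : ∀ τ : State, (∀ a, a ≠ A → τ.mem a = σ.mem a) → ∀ i k, τ.reg 3 = i →
      (before.Holds (τ.setReg 4 k) ↔ lt k i))
    (hF : ∀ τ : State, (∀ a, a ≠ A → τ.mem a = σ.mem a) → τ.reg 1 = n → ∀ i, τ.reg 3 = i →
      τ.mem A i = 0 → (body.run τ).mem A = Function.update (τ.mem A) i (F i (τ.mem A))) :
    ∀ i < n, ((scan before body).run σ).mem A i =
      F i fun j => if j < n ∧ lt j i then ((scan before body).run σ).mem A j else 0 := by
  set rank : ℕ → ℕ := fun i => ((Finset.range n).filter fun k => lt k i).card with hrank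
  have hlt : ∀ i j, i < n → j < n → (rank i < rank j ↔ lt i j) := fun i j hi hj =>
    card_filter_lt_iff htr hirr htot hi hj
  have hrn : ∀ i < n, rank i < n := by
    intro i hi
    refine (Finset.card_lt_card (Finset.ssubset_iff_of_subset (Finset.filter_subset _ _) |>.2
      ⟨i, ?_, ?_⟩)).trans_eq (Finset.card_range n)
    · simpa using hi
    · simp [hirr]
  have hinj : ∀ i j, i < n → j < n → rank i = rank j → i = j := by
    intro i j hi hj h
    by_contra hne
    rcases htot i j hne with h' | h'
    · exact absurd ((hlt i j hi hj).2 h') (by omega)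
    · exact absurd ((hlt j i hj hi).2 h') (by omega)
  set inner : Code := seq (sumLoop 6 4 1 before (.const 1))
    (ite (.eq (.var 6) (.var 2)) body skip) with hinner
  have hiw : ∀ z, z = 1 ∨ z = 2 ∨ z = 3 → inner.writes z = false := by
    rintro z (rfl | rfl | rfl) <;> simp [hinner, sumLoop, writes, hw1, hw2, hw3]
  have his : ∀ a, a ≠ A → inner.stores a = false := by
    intro a ha
    simp [hinner, sumLoop, stores, hst a ha]
  -- the invariant before number `i` of round `r`
  set P : ℕ → ℕ → (ℕ → ℕ) → Prop := fun r i v =>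
    (∀ k < n, (rank k < r ∨ rank k = r ∧ k < i) →
      v k = F k fun j => if j < n ∧ lt j k then v j else 0) ∧
    ∀ k, ¬ (k < n ∧ (rank k < r ∨ rank k = r ∧ k < i)) → v k = 0 with hP
  have hstep : ∀ r i, i < n → ∀ τ : State, (∀ a, a ≠ A → τ.mem a = σ.mem a) → τ.reg 1 = n →
      τ.reg 2 = r → τ.reg 3 = i → P r i (τ.mem A) → P r (i + 1) ((inner.run τ).mem A) := by
    intro r i hi τ hmem h1 h2 h3 hPi
    have hτ : ∀ a, ((sumLoop 6 4 1 before (.const 1)).run τ).mem a = τ.mem a := fun a =>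
      run_mem _ rfl _
    have hsum : ((sumLoop 6 4 1 before (.const 1)).run τ).reg 6 = rank i := by
      rw [run_sumLoop (by norm_num) (by norm_num) hr rfl, h1]
      simp only [hbefore τ hmem i _ h3, Expr.eval, hrank, Finset.card_filter]
    have hr2 : ((sumLoop 6 4 1 before (.const 1)).run τ).reg 2 = r := by rw [run_reg _ rfl, h2]
    rw [hinner, run, run_ite]
    simp only [Expr.holds_eq, Expr.eval, hsum, hr2]
    split_ifs with heq
    · have h0 : τ.mem A i = 0 := hPi.2 i (by omega)
      have hup := hF _ (fun a ha => (hτ a).trans (hmem a ha)) (by rw [run_reg _ rfl, h1]) i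
        (by rw [run_reg _ rfl, h3]) (by rw [hτ, h0])
      rw [hup, hτ]
      -- When `i` is visited, exactly its predecessors have been visited, so restricting the array
      -- to them changes nothing.
      have hres : τ.mem A = fun j => if j < n ∧ lt j i then τ.mem A j else 0 := by
        funext j
        split_ifs with hj
        · rfl
        · refine hPi.2 j fun hcon => ?_
          rcases hcon.2 with h | h
          · exact hj ⟨hcon.1, (hlt j i hcon.1 hi).1 (by omega)⟩
          · have := hinj j i hcon.1 hi (by omega)
            omega
      refine ⟨fun k hk hdone => ?_, fun k hk => ?_⟩
      -- Writing entry `i` does not disturb the equation of a visited `k`, since `i` does not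
      -- precede `k`.
      · have hne : ∀ j, (if j < n ∧ lt j k then
            Function.update (τ.mem A) i (F i (τ.mem A)) j else 0) =
            if j < n ∧ lt j k then τ.mem A j else 0 := by
          intro j
          rcases eq_or_ne j i with rfl | hj
          · have : ¬ lt j k := fun h => by
              have := (hlt j k hi hk).2 h
              omega
            simp [this]
          · simp [hj]
        simp only [hne]
        rcases eq_or_ne k i with rfl | hki
        · rw [← hres, Function.update_self]
        · rw [Function.update_of_ne hki]
          exact hPi.1 k hk (by omega)
      · rw [Function.update_of_ne (by rintro rfl; omega)]
        exact hPi.2 k (by omega)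
    · have hmemA : (skip.run ((sumLoop 6 4 1 before (.const 1)).run τ)).mem A = τ.mem A := hτ A
      rw [hmemA]
      have hiff : ∀ k, (rank k < r ∨ rank k = r ∧ k < i + 1) ↔
          (rank k < r ∨ rank k = r ∧ k < i) := by
        intro k
        rcases eq_or_ne k i with rfl | hki
        · omega
        · omega
      refine ⟨fun k hk hdone => hPi.1 k hk ((hiff k).1 hdone), fun k hk => hPi.2 k ?_⟩
      rwa [← hiff k]
  have hround : ∀ τ : State, ∀ r, (∀ a, a ≠ A → τ.mem a = σ.mem a) → τ.reg 1 = n → τ.reg 2 = r →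
      P r 0 (τ.mem A) → P (r + 1) 0 (((loop 3 1 inner).run τ).mem A) := by
    intro τ r hmem h1 h2 h0
    have := run_loop (p := inner) (x := 3) (y := 1) (σ := τ)
      (fun k ρ => P r k (ρ.mem A)) h0 fun k hk ρ h3 hreg hm hPk =>
        hstep r k (by omega) ρ (fun a ha => (hm a (his a ha)).trans (hmem a ha))
          ((hreg 1 (by omega) (hiw 1 (by omega))).trans h1)
          ((hreg 2 (by omega) (hiw 2 (by omega))).trans h2) h3 hPk
    rw [h1] at this
    refine ⟨fun k hk hd => this.1 k hk (by omega), fun k hk => this.2 k (by omega)⟩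
  have hfin : P n 0 (((scan before body).run σ).mem A) := by
    have := run_loop (p := loop 3 1 inner) (x := 2) (y := 1) (σ := σ)
      (fun r τ => P r 0 (τ.mem A))
      ⟨fun k _ hd => by omega, fun k _ => hA k⟩ fun r hr τ h2 hreg hm hPr =>
        hround τ r (fun a ha => hm a (his a ha))
          ((hreg 1 (by omega) (by simp [writes, hiw 1 (by omega)])).trans hn) h2 hPr
    rwa [hn] at this
  exact fun i hi => hfin.1 i hi (Or.inl (hrn i hi))

end RAM

namespace RAM

/-! ### The algorithm

Register `3` holds the current task and register `4` the task it is compared with. Array `7` holds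
the bottleneck capacities. -/

namespace Code

/-- Computes the bottleneck capacities. -/
def bottlenecks : Code :=
  loop 3 1 (seq (assign 9 (.const 0)) (seq
    (loop 4 0 (ite (.and (.and (.le (.arr 1 (.var 3)) (.var 4)) (.lt (.var 4) (.arr 2 (.var 3))))
      (.or (.eq (.var 9) (.const 0)) (.lt (.arr 0 (.var 4)) (.var 9))))
      (assign 9 (.arr 0 (.var 4))) skip))
    (store 7 (.var 3) (.var 9))))

/-- The number in register `x` precedes that in register `y` in the order given by array `K`. -/
def beforeExpr (K x y : ℕ) : Expr :=
  .or (.lt (.arr K (.var x)) (.arr K (.var y)))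
    (.and (.eq (.arr K (.var x)) (.arr K (.var y))) (.lt (.var x) (.var y)))

/-- The conflict of the tasks in registers `3` and `4`. -/
def conflictExpr (lo : ℕ → Expr) : Expr :=
  .or (.eq (.arr 5 (.var 3)) (.arr 5 (.var 4)))
    (.and (.and (.lt (.arr 1 (.var 3)) (.arr 2 (.var 4))) (.lt (.arr 1 (.var 4)) (.arr 2 (.var 3))))
      (.and (.lt (lo 3) (.arr 7 (.var 4))) (.lt (lo 4) (.arr 7 (.var 3)))))

/-- Takes the current task into `A` if it is eligible and has no conflict with those taken. -/
def greedyBody (A : ℕ) (elig : Expr) (lo : ℕ → Expr) : Code :=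
  seq (sumLoop 6 4 1 (.and (.arr A (.var 4)) (conflictExpr lo)) (.const 1))
    (ite (.and elig (.eq (.var 6) (.const 0))) (store A (.var 3) (.const 1)) skip)

/-- `reg 9` is increased up to `k` times, while the current task is not covered. -/
def raise : ℕ → Code
  | 0 => assign 9 (.const 0)
  | k + 1 => seq (raise k) (ite (.lt
      (.add (.mul (.arr 7 (.var 3)) (.add (.var 7) (.var 9)))
        (.mul (.mul (.const 4) (.arr 3 (.var 3))) (.var 8)))
      (.mul (.const 5) (.arr 7 (.var 3)))) (assign 9 (.add (.var 9) (.const 1))) skip)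

/-- Computes the multiplicity of the current task in array `8`. -/
def raiseBody : Code :=
  seq (sumLoop 7 4 1 (.eq (.arr 5 (.var 4)) (.arr 5 (.var 3))) (.arr 8 (.var 4))) (seq
    (sumLoop 8 4 1 (.and (.and (.lt (.arr 7 (.var 4)) (.two (.arr 7 (.var 3))))
      (.lt (.arr 7 (.var 3)) (.two (.arr 7 (.var 4)))))
      (.lt (.arr 1 (.var 3)) (.arr 2 (.var 4)))) (.arr 8 (.var 4))) (seq
    (raise 5)
    (ite (.le (.two (.two (.arr 3 (.var 3)))) (.arr 7 (.var 3))) (store 8 (.var 3) (.var 9)) skip)))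

/-- Takes the current task into array `13` if its multiplicity is nonzero and it fits. -/
def selectBody : Code :=
  seq (sumLoop 7 4 1 (.and (.arr 13 (.var 4)) (.eq (.arr 5 (.var 4)) (.arr 5 (.var 3)))) (.const 1))
    (seq (assign 8 (.const 0)) (seq
    (loop 5 1 (seq
      (sumLoop 10 4 1 (.and (.arr 13 (.var 4)) (.and (.lt (.arr 1 (.var 4)) (.arr 2 (.var 3)))
        (.and (.lt (.arr 7 (.var 5)) (.two (.arr 7 (.var 4)))) (.le (.arr 7 (.var 4))
          (.arr 7 (.var 5)))))) (.arr 3 (.var 4)))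
      (ite (.and (.le (.arr 7 (.var 3)) (.arr 7 (.var 5))) (.and
        (.lt (.arr 7 (.var 5)) (.two (.arr 7 (.var 3))))
        (.lt (.arr 7 (.var 5)) (.two (.add (.arr 3 (.var 3)) (.var 10))))))
        (assign 8 (.const 1)) skip)))
    (ite (.and (.arr 8 (.var 3)) (.and (.eq (.var 7) (.const 0)) (.eq (.var 8) (.const 0))))
      (store 13 (.var 3) (.const 1)) skip)))

/-- Replaces array `6` by array `X` if the latter has more nonzero entries. -/
def keepBest (X : ℕ) : Code :=
  seq (sumLoop 7 4 1 (.arr 6 (.var 4)) (.const 1)) (seq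
    (sumLoop 8 4 1 (.arr X (.var 4)) (.const 1))
    (ite (.lt (.var 7) (.var 8)) (loop 4 1 (store 6 (.var 4) (.arr X (.var 4)))) skip))

/-- Height of the lower side of a task at its bottleneck. -/
def loExpr (x : ℕ) : Expr := .sub (.arr 7 (.var x)) (.arr 3 (.var x))

/-- The greedy set of disjoint intervals. -/
def greedyIntervals : Code :=
  scan (beforeExpr 2 4 3) (greedyBody 10 (.le (.arr 3 (.var 3)) (.arr 7 (.var 3)))
    fun _ => .const 0)

/-- The greedy set of large tasks. -/
def greedyLarge : Code :=
  scan (beforeExpr 7 4 3) (greedyBody 11 (.and (.le (.arr 3 (.var 3)) (.arr 7 (.var 3)))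
    (.lt (.arr 7 (.var 3)) (.two (.arr 3 (.var 3))))) loExpr)

/-- The greedy set of medium tasks. -/
def greedyMedium : Code :=
  scan (beforeExpr 2 4 3) (greedyBody 12 (.and (.le (.two (.arr 3 (.var 3))) (.arr 7 (.var 3)))
    (.lt (.arr 7 (.var 3)) (.two (.two (.arr 3 (.var 3)))))) loExpr)

/-- The multiplicities of the small tasks. -/
def raiseSmall : Code := scan (beforeExpr 2 4 3) raiseBody

/-- The selection of small tasks. -/
def selectSmall : Code := scan (beforeExpr 2 3 4) selectBody

/-- The approximation algorithm for unweighted bagUFP. -/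
def bagUFP : Code :=
  seq bottlenecks (seq greedyIntervals (seq greedyLarge (seq greedyMedium (seq raiseSmall
    (seq selectSmall (seq (keepBest 10) (seq (keepBest 11) (seq (keepBest 12) (keepBest 13)))))))))

theorem wf_bagUFP : bagUFP.Wf := by decide

/-! ### Correctness of the parts -/

/-- Precedence in the order given by an array. -/
def Before (K : ℕ → ℕ) (i j : ℕ) : Prop := K i < K j ∨ K i = K j ∧ i < j

instance (K : ℕ → ℕ) : DecidableRel (Before K) := fun _ _ => inferInstanceAs (Decidable (_ ∨ _))

theorem Before.trans {K : ℕ → ℕ} (i j k : ℕ) (h₁ : Before K i j) (h₂ : Before K j k) :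
    Before K i k := by
  simp only [Before] at *; omega

theorem Before.irrefl {K : ℕ → ℕ} (i : ℕ) : ¬ Before K i i := by
  simp only [Before]; omega

theorem Before.total {K : ℕ → ℕ} (i j : ℕ) (h : i ≠ j) : Before K i j ∨ Before K j i := by
  simp only [Before]; omega

theorem holds_beforeExpr (K x y : ℕ) (σ : State) :
    (beforeExpr K x y).Holds σ ↔ Before (σ.mem K) (σ.reg x) (σ.reg y) := by
  simp [beforeExpr, Before, Expr.eval]

theorem run_mem_eq {p : Code} (h : ∀ a, p.stores a = false) (σ : State) :
    (p.run σ).mem = σ.mem :=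
  funext fun a => p.run_mem (h a) σ

theorem sumLoop_mem (acc j y : ℕ) (c v : Expr) (σ : State) :
    ((sumLoop acc j y c v).run σ).mem = σ.mem :=
  run_mem_eq (fun _ => rfl) σ

theorem run_count_eq_zero {c : Expr} {acc : ℕ} (hacc : acc ≠ 4) (hacc' : acc ≠ 1)
    (hc : c.reads acc = false) {τ : State} {n : ℕ} (h1 : τ.reg 1 = n) :
    ((sumLoop acc 4 1 c (.const 1)).run τ).reg acc = 0 ↔ ∀ j < n, ¬ c.Holds (τ.setReg 4 j) := by
  rw [run_sumLoop hacc hacc'.symm hc rfl, h1, Finset.sum_eq_zero_iff]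
  simp [Expr.eval]

theorem ite_one_zero_ne_zero (P : Prop) [Decidable P] : (if P then 1 else 0) ≠ 0 ↔ P := by
  simp

/-- The result of a greedy scan. -/
theorem run_greedy {A K n : ℕ} {σ : State} {elig : Expr} {lo : ℕ → Expr} (hn : σ.reg 1 = n)
    (hA : ∀ i, σ.mem A i = 0) (hK : K ≠ A) (hr : (conflictExpr lo).reads 6 = false)
    (E : ℕ → Prop) (C : ℕ → ℕ → Prop)
    (hE : ∀ τ : State, (∀ a, a ≠ A → τ.mem a = σ.mem a) → (elig.Holds τ ↔ E (τ.reg 3)))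
    (hC : ∀ τ : State, (∀ a, a ≠ A → τ.mem a = σ.mem a) →
      ((conflictExpr lo).Holds τ ↔ C (τ.reg 3) (τ.reg 4))) :
    ∀ i < n, (((scan (beforeExpr K 4 3) (greedyBody A elig lo)).run σ).mem A i ≠ 0 ↔
      E i ∧ ∀ j < n, ((scan (beforeExpr K 4 3) (greedyBody A elig lo)).run σ).mem A j ≠ 0 →
        Before (σ.mem K) j i → ¬ C i j) := by
  classical
  intro i hi
  have := run_scan (before := beforeExpr K 4 3) (body := greedyBody A elig lo) (A := A)
    (Before (σ.mem K)) (fun i v => if E i ∧ ∀ j < n, v j ≠ 0 → ¬ C i j then 1 else 0) hn hA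
    Before.trans Before.irrefl Before.total rfl rfl rfl
    (fun a ha => by simp [greedyBody, sumLoop, stores, ha.symm]) rfl
    (fun τ hτ i k h3 => by
      rw [holds_beforeExpr]
      simp [State.setReg_reg, h3, hτ K hK])
    (fun τ hτ h1 i h3 h0 => by
      have hmem := sumLoop_mem 6 4 1 (.and (.arr A (.var 4)) (conflictExpr lo)) (.const 1) τ
      have hcnt := run_count_eq_zero (c := .and (.arr A (.var 4)) (conflictExpr lo)) (acc := 6)
        (by norm_num) (by norm_num) (by simpa [Expr.and, Expr.reads] using hr) h1
      have h3' : ((sumLoop 6 4 1 (.and (.arr A (.var 4)) (conflictExpr lo)) (.const 1)).run τ).reg 3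
          = i := by rw [run_reg _ rfl, h3]
      have hE' := hE _ (fun a ha => (congrFun hmem a).trans (hτ a ha))
      rw [greedyBody, run_seq, run_ite]
      simp only [Expr.holds_and, hE', h3', Expr.holds_eq, Expr.eval, hcnt, Expr.holds_arr,
        State.setReg_mem, State.setReg_reg_self]
      have hC' : ∀ j, (conflictExpr lo).Holds (τ.setReg 4 j) ↔ C i j := fun j => by
        rw [hC (τ.setReg 4 j) hτ]
        simp [State.setReg_reg, h3]
      simp only [hC', not_and]
      split_ifs with h
      · simp [run, State.setMem, Expr.eval, h3', hmem]
      · rw [run, hmem, ← h0, Function.update_eq_self]) i hi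
  rw [this, ite_one_zero_ne_zero]
  refine and_congr_right fun _ => forall₂_congr fun j hj => ?_
  by_cases hb : Before (σ.mem K) j i <;> simp [hj, hb]

/-- Number of increases of a multiplicity until a task with bottleneck `b` and demand `d` is
covered. -/
def raiseCount (b Z d Y : ℕ) : ℕ → ℕ
  | 0 => 0
  | k + 1 => if b * (Z + raiseCount b Z d Y k) + 4 * d * Y < 5 * b then raiseCount b Z d Y k + 1
      else raiseCount b Z d Y k

/-- A raise happens only below `5 * b` and adds exactly `b`, so the result stays below `6 * b`; if 5
is never reached, all `k` raises took place. -/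
theorem raiseCount_spec (b Z d Y k : ℕ) :
    (raiseCount b Z d Y k ≠ 0 → b * (Z + raiseCount b Z d Y k) + 4 * d * Y < 6 * b) ∧
      (5 * b ≤ b * (Z + raiseCount b Z d Y k) + 4 * d * Y ∨ raiseCount b Z d Y k = k) := by
  induction k with
  | zero => simp [raiseCount]
  | succ k ih =>
    rw [raiseCount]
    split_ifs with h
    · refine ⟨fun _ => ?_, ?_⟩
      · rw [← add_assoc, mul_add, mul_one]; omega
      · right; omega
    · exact ⟨ih.1, Or.inl (not_lt.1 h)⟩

theorem raise_stores (k a : ℕ) : (raise k).stores a = false := by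
  induction k with
  | zero => rfl
  | succ k ih => simp [raise, stores, ih]

theorem raise_writes (k z : ℕ) (hz : z ≠ 9) : (raise k).writes z = false := by
  induction k with
  | zero => simp [raise, writes, hz.symm]
  | succ k ih => simp [raise, writes, ih, hz.symm]

theorem run_raise (k : ℕ) (τ : State) : ((raise k).run τ).reg 9 =
    raiseCount (τ.mem 7 (τ.reg 3)) (τ.reg 7) (τ.mem 3 (τ.reg 3)) (τ.reg 8) k := by
  induction k with
  | zero => simp [raise, run, raiseCount, Expr.eval]
  | succ k ih =>
    rw [raise, run, run_ite, raiseCount]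
    simp only [Expr.holds_lt, Expr.eval, run_reg _ (raise_writes k 3 (by norm_num)),
      run_reg _ (raise_writes k 7 (by norm_num)), run_reg _ (raise_writes k 8 (by norm_num)),
      run_mem _ (raise_stores k _), ih]
    split_ifs <;> simp [run, Expr.eval, ih]

/-- The result of the first scan of the local ratio method. -/
theorem run_raiseSmall {n : ℕ} {σ : State} (hn : σ.reg 1 = n) (hA : ∀ i, σ.mem 8 i = 0) :
    ∀ i < n, (raiseSmall.run σ).mem 8 i = if 4 * σ.mem 3 i ≤ σ.mem 7 i then
      raiseCount (σ.mem 7 i)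
        (∑ j ∈ Finset.range n, if σ.mem 5 j = σ.mem 5 i then
          (if j < n ∧ Before (σ.mem 2) j i then (raiseSmall.run σ).mem 8 j else 0) else 0)
        (σ.mem 3 i)
        (∑ j ∈ Finset.range n, if (σ.mem 7 j < 2 * σ.mem 7 i ∧ σ.mem 7 i < 2 * σ.mem 7 j) ∧
          σ.mem 1 i < σ.mem 2 j then
          (if j < n ∧ Before (σ.mem 2) j i then (raiseSmall.run σ).mem 8 j else 0) else 0) 5
      else 0 := by
  refine run_scan (Before (σ.mem 2)) (fun i v => if 4 * σ.mem 3 i ≤ σ.mem 7 i then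
      raiseCount (σ.mem 7 i)
        (∑ j ∈ Finset.range n, if σ.mem 5 j = σ.mem 5 i then v j else 0) (σ.mem 3 i)
        (∑ j ∈ Finset.range n, if (σ.mem 7 j < 2 * σ.mem 7 i ∧ σ.mem 7 i < 2 * σ.mem 7 j) ∧
          σ.mem 1 i < σ.mem 2 j then v j else 0) 5
      else 0) hn hA Before.trans Before.irrefl Before.total rfl rfl rfl
    (fun a ha => by simp [raiseBody, raise, sumLoop, stores, ha.symm]) rfl
    (fun τ hτ i k h3 => by
      rw [holds_beforeExpr]
      simp [State.setReg_reg, h3, hτ 2 (by norm_num)]) ?_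
  intro τ hτ h1 i h3 h0
  have m1 := hτ 1 (by norm_num)
  have m2 := hτ 2 (by norm_num)
  have m3 := hτ 3 (by norm_num)
  have m5 := hτ 5 (by norm_num)
  have m7 := hτ 7 (by norm_num)
  rw [raiseBody, run_seq, run_seq, run_seq, run_ite]
  set τ₁ := (sumLoop 7 4 1 (.eq (.arr 5 (.var 4)) (.arr 5 (.var 3))) (.arr 8 (.var 4))).run τ
    with hτ₁
  have hm₁ : τ₁.mem = τ.mem := sumLoop_mem _ _ _ _ _ _
  have hZ : τ₁.reg 7 = ∑ j ∈ Finset.range n, if σ.mem 5 j = σ.mem 5 i then τ.mem 8 j else 0 := by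
    rw [hτ₁, run_sumLoop (by norm_num) (by norm_num) rfl rfl, h1]
    simp [Expr.eval, State.setReg_reg, h3, m5]
  have h13 : τ₁.reg 3 = i := by rw [hτ₁, run_reg _ rfl, h3]
  have h11 : τ₁.reg 1 = n := by rw [hτ₁, run_reg _ rfl, h1]
  clear_value τ₁
  set τ₂ := (sumLoop 8 4 1 (.and (.and (.lt (.arr 7 (.var 4)) (.two (.arr 7 (.var 3))))
      (.lt (.arr 7 (.var 3)) (.two (.arr 7 (.var 4)))))
      (.lt (.arr 1 (.var 3)) (.arr 2 (.var 4)))) (.arr 8 (.var 4))).run τ₁ with hτ₂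
  have hm₂ : τ₂.mem = τ.mem := (sumLoop_mem _ _ _ _ _ _).trans hm₁
  have hY : τ₂.reg 8 = ∑ j ∈ Finset.range n,
      if (σ.mem 7 j < 2 * σ.mem 7 i ∧ σ.mem 7 i < 2 * σ.mem 7 j) ∧
        σ.mem 1 i < σ.mem 2 j then τ.mem 8 j else 0 := by
    rw [hτ₂, run_sumLoop (by norm_num) (by norm_num) rfl rfl, h11]
    simp [Expr.eval, State.setReg_reg, h13, m1, m2, m7, hm₁]
  have h23 : τ₂.reg 3 = i := by rw [hτ₂, run_reg _ rfl, h13]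
  have h27 : τ₂.reg 7 = τ₁.reg 7 := by rw [hτ₂, run_reg _ rfl]
  clear_value τ₂
  have h9 := run_raise 5 τ₂
  have h33 := run_reg _ (raise_writes 5 3 (by norm_num)) τ₂
  have hm₃ := run_mem_eq (raise_stores 5) τ₂
  simp only [Expr.holds_le, Expr.eval_two, Expr.eval, h33, h23, hm₃, hm₂, m3, m7, ← mul_assoc]
  norm_num only
  split_ifs with h
  · simp [run, State.setMem, Expr.eval, h33, h23, h9, hm₃, hm₂, m3, m7, hY, h27, hZ]
  · rw [run, hm₃, hm₂, ← h0, Function.update_eq_self]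

/-- The result of the second scan of the local ratio method. -/
theorem run_selectSmall {n : ℕ} {σ : State} (hn : σ.reg 1 = n) (hA : ∀ i, σ.mem 13 i = 0) :
    ∀ i < n, ((selectSmall.run σ).mem 13 i ≠ 0 ↔ σ.mem 8 i ≠ 0 ∧
      (∀ j < n, (selectSmall.run σ).mem 13 j ≠ 0 → Before (σ.mem 2) i j →
        σ.mem 5 j ≠ σ.mem 5 i) ∧
      ∀ k < n, σ.mem 7 i ≤ σ.mem 7 k → σ.mem 7 k < 2 * σ.mem 7 i →
        2 * (σ.mem 3 i + ∑ j ∈ Finset.range n, if ((selectSmall.run σ).mem 13 j ≠ 0 ∧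
          Before (σ.mem 2) i j) ∧ σ.mem 1 j < σ.mem 2 i ∧ σ.mem 7 k < 2 * σ.mem 7 j ∧
          σ.mem 7 j ≤ σ.mem 7 k then σ.mem 3 j else 0) ≤ σ.mem 7 k) := by
  classical
  intro i hi
  have := run_scan (before := beforeExpr 2 3 4) (body := selectBody) (A := 13)
    -- The order is reversed: the selection visits the tasks by decreasing rank.
    (fun i j => Before (σ.mem 2) j i) (fun i v => if σ.mem 8 i ≠ 0 ∧
      (∀ j < n, v j ≠ 0 → σ.mem 5 j ≠ σ.mem 5 i) ∧
      ∀ k < n, ¬ (σ.mem 7 i ≤ σ.mem 7 k ∧ σ.mem 7 k < 2 * σ.mem 7 i ∧ σ.mem 7 k <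
        2 * (σ.mem 3 i + ∑ j ∈ Finset.range n, if v j ≠ 0 ∧
          σ.mem 1 j < σ.mem 2 i ∧ σ.mem 7 k < 2 * σ.mem 7 j ∧
          σ.mem 7 j ≤ σ.mem 7 k then σ.mem 3 j else 0)) then 1 else 0) hn hA
    (fun i j k h₁ h₂ => h₂.trans _ _ _ h₁) Before.irrefl (fun i j h => Before.total j i h.symm)
    rfl rfl rfl
    (fun a ha => by simp [selectBody, sumLoop, stores, ha.symm]) rfl
    (fun τ hτ i k h3 => by
      rw [holds_beforeExpr]
      simp [State.setReg_reg, h3, hτ 2 (by norm_num)]) ?_ i hi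
  · change (selectSmall.run σ).mem 13 i = _ at this
    rw [this, ite_one_zero_ne_zero]
    refine and_congr_right fun _ => and_congr (forall₂_congr fun j hj => ?_)
      (forall₂_congr fun k _ => ?_)
    · by_cases hb : Before (σ.mem 2) i j <;> simp [hj, hb, selectSmall]
    · rw [not_and, not_and]
      refine imp_congr_right fun _ => imp_congr_right fun _ => ?_
      have : ∀ j ∈ Finset.range n, (if (if j < n ∧ Before (σ.mem 2) i j then
            ((scan (beforeExpr 2 3 4) selectBody).run σ).mem 13 j else 0) ≠ 0 ∧
          σ.mem 1 j < σ.mem 2 i ∧ σ.mem 7 k < 2 * σ.mem 7 j ∧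
          σ.mem 7 j ≤ σ.mem 7 k then σ.mem 3 j else 0) =
          if ((selectSmall.run σ).mem 13 j ≠ 0 ∧ Before (σ.mem 2) i j) ∧
            σ.mem 1 j < σ.mem 2 i ∧ σ.mem 7 k < 2 * σ.mem 7 j ∧
            σ.mem 7 j ≤ σ.mem 7 k then σ.mem 3 j else 0 := by
        intro j hj
        rw [Finset.mem_range] at hj
        by_cases hb : Before (σ.mem 2) i j <;> simp [hj, hb, selectSmall]
      rw [Finset.sum_congr rfl this, not_lt]
  intro τ hτ h1 i h3 h0
  have m1 := hτ 1 (by norm_num)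
  have m2 := hτ 2 (by norm_num)
  have m3 := hτ 3 (by norm_num)
  have m5 := hτ 5 (by norm_num)
  have m7 := hτ 7 (by norm_num)
  have m8 := hτ 8 (by norm_num)
  rw [selectBody, run_seq, run_seq, run_seq, run_ite]
  set c₁ : Expr := .and (.arr 13 (.var 4)) (.eq (.arr 5 (.var 4)) (.arr 5 (.var 3))) with hc₁
  set τ₁ := (assign 8 (.const 0)).run ((sumLoop 7 4 1 c₁ (.const 1)).run τ) with hτ₁
  have hm₁ : τ₁.mem = τ.mem := sumLoop_mem 7 4 1 c₁ (.const 1) τ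
  have hbag : τ₁.reg 7 = 0 ↔ ∀ j < n, τ.mem 13 j ≠ 0 → σ.mem 5 j ≠ σ.mem 5 i := by
    have : τ₁.reg 7 = ((sumLoop 7 4 1 c₁ (.const 1)).run τ).reg 7 := run_reg _ rfl _
    rw [this, run_count_eq_zero (by norm_num) (by norm_num) rfl h1]
    simp [hc₁, Expr.eval, State.setReg_reg, h3, m5]
  have h13 : τ₁.reg 3 = i := by
    rw [hτ₁, run_reg (assign _ _) rfl, run_reg _ rfl, h3]
  have h11 : τ₁.reg 1 = n := by
    rw [hτ₁, run_reg (assign _ _) rfl, run_reg _ rfl, h1]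
  have h18 : τ₁.reg 8 = 0 := State.setReg_reg_self _ _ _
  clear_value τ₁
  set c₂ : Expr := .and (.arr 13 (.var 4)) (.and (.lt (.arr 1 (.var 4)) (.arr 2 (.var 3)))
        (.and (.lt (.arr 7 (.var 5)) (.two (.arr 7 (.var 4)))) (.le (.arr 7 (.var 4))
          (.arr 7 (.var 5))))) with hc₂
  set body : Code := seq (sumLoop 10 4 1 c₂ (.arr 3 (.var 4)))
    (ite (.and (.le (.arr 7 (.var 3)) (.arr 7 (.var 5))) (.and
        (.lt (.arr 7 (.var 5)) (.two (.arr 7 (.var 3))))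
        (.lt (.arr 7 (.var 5)) (.two (.add (.arr 3 (.var 3)) (.var 10))))))
        (assign 8 (.const 1)) skip) with hbody
  have hm₂ : ((loop 5 1 body).run τ₁).mem = τ.mem :=
    (run_mem_eq (fun _ => rfl) _).trans hm₁
  have h23 : ((loop 5 1 body).run τ₁).reg 3 = i := by rw [run_reg _ rfl, h13]
  have h27 : ((loop 5 1 body).run τ₁).reg 7 = τ₁.reg 7 := run_reg _ rfl _
  -- Register `8` is a flag, set once some window `k` would be overfilled.
  have hfit : ((loop 5 1 body).run τ₁).reg 8 = 0 ↔ ∀ k < n,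
      ¬ (σ.mem 7 i ≤ σ.mem 7 k ∧ σ.mem 7 k < 2 * σ.mem 7 i ∧ σ.mem 7 k <
        2 * (σ.mem 3 i + ∑ j ∈ Finset.range n, if τ.mem 13 j ≠ 0 ∧
          σ.mem 1 j < σ.mem 2 i ∧ σ.mem 7 k < 2 * σ.mem 7 j ∧
          σ.mem 7 j ≤ σ.mem 7 k then σ.mem 3 j else 0)) := by
    have := run_loop (p := body) (x := 5) (y := 1) (σ := τ₁) (fun l ρ => ρ.reg 8 = 0 ↔ ∀ k < l,
      ¬ (σ.mem 7 i ≤ σ.mem 7 k ∧ σ.mem 7 k < 2 * σ.mem 7 i ∧ σ.mem 7 k <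
        2 * (σ.mem 3 i + ∑ j ∈ Finset.range n, if τ.mem 13 j ≠ 0 ∧
          σ.mem 1 j < σ.mem 2 i ∧ σ.mem 7 k < 2 * σ.mem 7 j ∧
          σ.mem 7 j ≤ σ.mem 7 k then σ.mem 3 j else 0))) (by simp [State.setReg_reg, h18]) ?_
    · rwa [h11] at this
    intro k hk ρ h5 hreg hmem ih
    have hmρ : ρ.mem = τ.mem := funext fun a => (hmem a rfl).trans (congrFun hm₁ a)
    have h1ρ : ρ.reg 1 = n := (hreg 1 (by norm_num) rfl).trans h11
    have h3ρ : ρ.reg 3 = i := (hreg 3 (by norm_num) rfl).trans h13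
    rw [State.setReg_reg_of_ne _ _ (by norm_num), hbody, run, run_ite]
    set ρ₁ := (sumLoop 10 4 1 c₂ (.arr 3 (.var 4))).run ρ with hρ₁
    have hL : ρ₁.reg 10 = ∑ j ∈ Finset.range n, if τ.mem 13 j ≠ 0 ∧
          σ.mem 1 j < σ.mem 2 i ∧ σ.mem 7 k < 2 * σ.mem 7 j ∧
          σ.mem 7 j ≤ σ.mem 7 k then σ.mem 3 j else 0 := by
      rw [hρ₁, run_sumLoop (by norm_num) (by norm_num) rfl rfl, h1ρ]
      simp [hc₂, Expr.eval, State.setReg_reg, h3ρ, h5, hmρ, m1, m2, m3, m7]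
    have r3 : ρ₁.reg 3 = i := by rw [hρ₁, run_reg _ rfl, h3ρ]
    have r5 : ρ₁.reg 5 = k := by rw [hρ₁, run_reg _ rfl, h5]
    have r8 : ρ₁.reg 8 = ρ.reg 8 := run_reg _ rfl _
    have rm : ρ₁.mem = τ.mem := (sumLoop_mem _ _ _ _ _ _).trans hmρ
    clear_value ρ₁
    simp only [Expr.holds_and, Expr.holds_le, Expr.holds_lt, Expr.eval_two, Expr.eval, r3, r5, rm,
      m3, m7, hL, Nat.lt_succ_iff_lt_or_eq, or_imp, forall_and, forall_eq]
    split_ifs with h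
    · simp [run, Expr.eval, h]
    · rw [run, r8, ih]
      exact (and_iff_left h).symm
  simp only [Expr.holds_and, Expr.holds_arr, Expr.holds_eq, Expr.eval, hm₂, h23, h27, m8, hbag,
    hfit]
  split_ifs with h
  · rw [run]
    simp [State.setMem, Expr.eval, h23, hm₂]
  · rw [run, hm₂, ← h0, Function.update_eq_self]

end Code
end RAM

namespace BagUFP

open RAM RAM.Code

variable {I : BagUFP}

/-! ### Correctness of the algorithm -/

/-- The memory holds the instance and its bottleneck capacities. -/
structure Loaded (I : BagUFP) (σ : State) : Prop where
  num : σ.reg 1 = I.n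
  source : ∀ i : Fin I.n, σ.mem 1 i = I.source i
  target : ∀ i : Fin I.n, σ.mem 2 i = I.target i
  demand : ∀ i : Fin I.n, σ.mem 3 i = I.demand i
  bag : ∀ i : Fin I.n, σ.mem 5 i = I.bag i
  bot : ∀ i : Fin I.n, σ.mem 7 i = I.bot i

theorem Loaded.run {σ : State} (h : I.Loaded σ) (p : Code) (hr : p.writes 1 = false)
    (hm : ∀ a, a = 1 ∨ a = 2 ∨ a = 3 ∨ a = 5 ∨ a = 7 → p.stores a = false) :
    I.Loaded (p.run σ) where
  num := by rw [p.run_reg hr, h.num]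
  source i := by rw [p.run_mem (hm 1 (by simp)), h.source]
  target i := by rw [p.run_mem (hm 2 (by simp)), h.target]
  demand i := by rw [p.run_mem (hm 3 (by simp)), h.demand]
  bag i := by rw [p.run_mem (hm 5 (by simp)), h.bag]
  bot i := by rw [p.run_mem (hm 7 (by simp)), h.bot]

variable (I) in
/-- The set of tasks with nonzero entry in array `A`. -/
def chosen (A : ℕ) (σ : State) : Finset (Fin I.n) := Finset.univ.filter fun i => σ.mem A i ≠ 0

@[simp] theorem mem_chosen {A : ℕ} {σ : State} {i : Fin I.n} :
    i ∈ I.chosen A σ ↔ σ.mem A i ≠ 0 := by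
  simp [chosen]

theorem chosen_congr {A : ℕ} {σ τ : State} (h : σ.mem A = τ.mem A) :
    I.chosen A σ = I.chosen A τ := by
  simp [chosen, h]

/-- Of two conflicting members the later one would have been rejected, and a rejected eligible task
has an earlier conflicting member. `Before` breaks ties by index, so only `≤` of the keys survives.
-/
theorem isGreedy_of_iff {elig : Fin I.n → Prop} {lo : Fin I.n → ℕ} {G : Finset (Fin I.n)}
    {K : ℕ → ℕ}
    (h : ∀ i, i ∈ G ↔ elig i ∧ ∀ j ∈ G, Before K j i → ¬ Conflict lo i j) :
    IsGreedy elig lo (fun i => K i) G where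
  eligible i hi := ((h i).1 hi).1
  indep i hi j hj hne hc := by
    rcases Before.total (K := K) i j (by simpa [Fin.ext_iff] using hne) with hb | hb
    · exact ((h j).1 hj).2 i hi hb hc.symm
    · exact ((h i).1 hi).2 j hj hb hc
  exists_conflict i hi := by
    by_cases hG : i ∈ G
    · exact ⟨i, hG, le_rfl, Or.inl rfl⟩
    · have := mt (h i).2 hG
      push Not at this
      obtain ⟨j, hj, hb, hc⟩ := this hi
      exact ⟨j, hj, by simp only [Before] at hb; omega, hc⟩

/-- The hypotheses on `elig` and `lo` quantify over all states agreeing with `σ` outside `A`: only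
`A` changes among the arrays during the scan, so these tests keep their meaning. -/
theorem Loaded.isGreedy {A K : ℕ} {σ : State} {elig : Expr} {lo : ℕ → Expr} (hσ : I.Loaded σ)
    (hA : ∀ i, σ.mem A i = 0) (hK : K ≠ A) (hr : (conflictExpr lo).reads 6 = false)
    (hne : 1 ≠ A ∧ 2 ≠ A ∧ 5 ≠ A ∧ 7 ≠ A) (E : ℕ → Prop) (L : ℕ → ℕ)
    (hE : ∀ τ : State, (∀ a, a ≠ A → τ.mem a = σ.mem a) → (elig.Holds τ ↔ E (τ.reg 3)))
    (hL : ∀ τ : State, (∀ a, a ≠ A → τ.mem a = σ.mem a) → ∀ x, (lo x).eval τ = L (τ.reg x)) :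
    IsGreedy (fun i : Fin I.n => E i) (fun i => L i) (fun i => σ.mem K i)
      (I.chosen A ((scan (beforeExpr K 4 3) (greedyBody A elig lo)).run σ)) := by
  refine isGreedy_of_iff fun i => ?_
  have := run_greedy (A := A) (K := K) hσ.num hA hK hr E (fun i j => σ.mem 5 i = σ.mem 5 j ∨
    ((σ.mem 1 i < σ.mem 2 j ∧ σ.mem 1 j < σ.mem 2 i) ∧ L i < σ.mem 7 j ∧ L j < σ.mem 7 i)) hE
    (fun τ hτ => by
      simp [conflictExpr, Expr.eval, hL τ hτ, hτ 1 hne.1, hτ 2 hne.2.1, hτ 5 hne.2.2.1,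
        hτ 7 hne.2.2.2]) i i.2
  rw [mem_chosen, this]
  refine and_congr_right fun _ => ⟨fun h j hj hb hc => ?_, fun h j hj hj' hb hc => ?_⟩
  · refine h j j.2 (mem_chosen.1 hj) hb ?_
    simpa [Conflict, Overlap, hσ.source, hσ.target, hσ.bag, hσ.bot] using hc
  · refine h ⟨j, hj⟩ (mem_chosen.2 hj') hb ?_
    have h1 := hσ.source ⟨j, hj⟩
    have h2 := hσ.target ⟨j, hj⟩
    have h5 := hσ.bag ⟨j, hj⟩
    have h7 := hσ.bot ⟨j, hj⟩
    simp only at h1 h2 h5 h7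
    simpa [Conflict, Overlap, hσ.source, hσ.target, hσ.bag, hσ.bot, h1, h2, h5, h7] using hc

theorem Loaded.greedyIntervals {σ : State} (hσ : I.Loaded σ) (h0 : ∀ i, σ.mem 10 i = 0) :
    IsGreedy (fun i => I.demand i ≤ I.bot i) (fun _ => 0) I.target
      (I.chosen 10 (greedyIntervals.run σ)) := by
  have := hσ.isGreedy (A := 10) (K := 2) (elig := .le (.arr 3 (.var 3)) (.arr 7 (.var 3)))
    (lo := fun _ => .const 0) h0 (by norm_num) rfl (by norm_num)
    (fun i => σ.mem 3 i ≤ σ.mem 7 i) (fun _ => 0)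
    (fun τ hτ => by simp [Expr.eval, hτ 3 (by norm_num), hτ 7 (by norm_num)])
    (fun τ hτ x => by simp [Expr.eval])
  simp only [hσ.target, hσ.demand, hσ.bot] at this
  exact this

theorem Loaded.greedyLarge {σ : State} (hσ : I.Loaded σ) (h0 : ∀ i, σ.mem 11 i = 0) :
    IsGreedy (fun i => I.demand i ≤ I.bot i ∧ I.bot i < 2 * I.demand i)
      (fun i => I.bot i - I.demand i) I.bot (I.chosen 11 (greedyLarge.run σ)) := by
  have := hσ.isGreedy (A := 11) (K := 7) (elig := .and (.le (.arr 3 (.var 3)) (.arr 7 (.var 3)))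
      (.lt (.arr 7 (.var 3)) (.two (.arr 3 (.var 3)))))
    (lo := loExpr) h0 (by norm_num) rfl (by norm_num)
    (fun i => σ.mem 3 i ≤ σ.mem 7 i ∧ σ.mem 7 i < 2 * σ.mem 3 i) (fun i => σ.mem 7 i - σ.mem 3 i)
    (fun τ hτ => by simp [Expr.eval, hτ 3 (by norm_num), hτ 7 (by norm_num)])
    (fun τ hτ x => by simp [loExpr, Expr.eval, hτ 3 (by norm_num), hτ 7 (by norm_num)])
  simp only [hσ.demand, hσ.bot] at this
  exact this

theorem Loaded.greedyMedium {σ : State} (hσ : I.Loaded σ) (h0 : ∀ i, σ.mem 12 i = 0) :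
    IsGreedy (fun i => 2 * I.demand i ≤ I.bot i ∧ I.bot i < 4 * I.demand i)
      (fun i => I.bot i - I.demand i) I.target (I.chosen 12 (greedyMedium.run σ)) := by
  have := hσ.isGreedy (A := 12) (K := 2)
    (elig := .and (.le (.two (.arr 3 (.var 3))) (.arr 7 (.var 3)))
      (.lt (.arr 7 (.var 3)) (.two (.two (.arr 3 (.var 3))))))
    (lo := loExpr) h0 (by norm_num) rfl (by norm_num)
    (fun i => 2 * σ.mem 3 i ≤ σ.mem 7 i ∧ σ.mem 7 i < 4 * σ.mem 3 i)
    (fun i => σ.mem 7 i - σ.mem 3 i)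
    (fun τ hτ => by
      simp only [Expr.holds_and, Expr.holds_le, Expr.holds_lt, Expr.eval_two, Expr.eval,
        hτ 3 (by norm_num), hτ 7 (by norm_num), ← mul_assoc]
      norm_num)
    (fun τ hτ x => by simp [loExpr, Expr.eval, hτ 3 (by norm_num), hτ 7 (by norm_num)])
  simp only [hσ.target, hσ.demand, hσ.bot] at this
  exact this

/-- The local ratio method on a loaded memory. -/
theorem Loaded.isLocalRatio {σ : State} (hσ : I.Loaded σ) (h8 : ∀ i, σ.mem 8 i = 0)
    (h13 : ∀ i, σ.mem 13 i = 0) :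
    ∃ rank p, IsLocalRatio (I := I) rank p
      (I.chosen 13 (selectSmall.run (raiseSmall.run σ))) := by
  classical
  set τ := raiseSmall.run σ with hτ
  have hτL : I.Loaded τ := hσ.run _ rfl (by rintro a (rfl | rfl | rfl | rfl | rfl) <;> rfl)
  set S := I.chosen 13 (selectSmall.run τ) with hS
  set rank : Fin I.n → ℕ := fun i =>
    ((Finset.range I.n).filter fun k => Before (σ.mem 2) k i).card with hrank
  have hlt : ∀ i j : Fin I.n, rank i < rank j ↔ Before (σ.mem 2) i j := fun i j =>
    card_filter_lt_iff Before.trans Before.irrefl Before.total i.2 j.2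
  have hinj : Function.Injective rank := by
    intro i j h
    by_contra hne
    rcases Before.total (K := σ.mem 2) i j (by simpa [Fin.ext_iff] using hne) with hb | hb
    · exact absurd ((hlt i j).2 hb) (by omega)
    · exact absurd ((hlt j i).2 hb) (by omega)
  have hp := run_raiseSmall hσ.num h8
  have hs := run_selectSmall hτL.num (fun i => by rw [hτ, run_mem _ rfl, h13])
  rw [← hτ] at hp
  set p : Fin I.n → ℕ := fun i => τ.mem 8 i with hpdef
  -- the sums computed in the first scan
  set Z : Fin I.n → ℕ := fun i => ∑ j ∈ Finset.range I.n, if σ.mem 5 j = σ.mem 5 i then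
        (if j < I.n ∧ Before (σ.mem 2) j i then τ.mem 8 j else 0) else 0 with hZdef
  set Y : Fin I.n → ℕ := fun i =>
    ∑ j, if rank j < rank i ∧ Sim j i ∧ I.source i < I.target j then p j else 0 with hYdef
  -- The program sums over strict predecessors only; the term `j = i` of the sum with `rank j ≤ rank
  -- i` is the multiplicity `p i` being determined.
  have hZ : ∀ i : Fin I.n, (∑ j, if rank j ≤ rank i ∧ I.bag j = I.bag i then p j else 0) =
      Z i + p i := by
    intro i
    simp only [hZdef]
    rw [Finset.sum_range]
    have : p i = ∑ j, if j = i then p j else 0 := by simp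
    rw [this, ← Finset.sum_add_distrib]
    refine Finset.sum_congr rfl fun j _ => ?_
    simp only [hσ.bag, Fin.is_lt, true_and, ← hlt]
    rcases eq_or_ne j i with rfl | hne
    · simp
    · have : rank j ≠ rank i := fun h => hne (hinj h)
      have h1 : rank j ≤ rank i ↔ rank j < rank i := by omega
      simp only [h1, if_neg hne, add_zero]
      by_cases hb : I.bag j = I.bag i <;> simp [hb, hpdef]
  have hY : ∀ i : Fin I.n, Y i =
      ∑ j ∈ Finset.range I.n, if (σ.mem 7 j < 2 * σ.mem 7 i ∧ σ.mem 7 i < 2 * σ.mem 7 j) ∧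
        σ.mem 1 i < σ.mem 2 j then
        (if j < I.n ∧ Before (σ.mem 2) j i then τ.mem 8 j else 0) else 0 := by
    intro i
    rw [Finset.sum_range]
    refine Finset.sum_congr rfl fun j _ => ?_
    simp only [hσ.bot, hσ.source, hσ.target, Fin.is_lt, true_and, ← hlt]
    rw [← ite_and]
    exact if_congr and_comm rfl rfl
  have hload : ∀ i k : Fin I.n, (∑ j ∈ S with rank i < rank j ∧ I.source j < I.target i ∧
      I.bot k < 2 * I.bot j ∧ I.bot j ≤ I.bot k, I.demand j) =
      ∑ j ∈ Finset.range I.n, if ((selectSmall.run τ).mem 13 j ≠ 0 ∧ Before (τ.mem 2) i j) ∧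
        τ.mem 1 j < τ.mem 2 i ∧ τ.mem 7 k < 2 * τ.mem 7 j ∧ τ.mem 7 j ≤ τ.mem 7 k
        then τ.mem 3 j else 0 := by
    intro i k
    have hσ2 : τ.mem 2 = σ.mem 2 := run_mem _ rfl _
    rw [Finset.sum_range, hS, chosen, Finset.filter_filter, Finset.sum_filter]
    refine Finset.sum_congr rfl fun j _ => ?_
    simp only [hτL.bot, hτL.source, hτL.target, hτL.demand]
    refine if_congr ?_ rfl rfl
    rw [hlt, hσ2, and_assoc]
  have hcount : ∀ i : Fin I.n, p i = if 4 * I.demand i ≤ I.bot i then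
      raiseCount (I.bot i) (Z i) (I.demand i) (Y i) 5 else 0 := fun i => by
    have := hp i i.2
    rw [← hY, hσ.demand, hσ.bot] at this
    exact this
  have hsmall : ∀ i, p i ≠ 0 → 4 * I.demand i ≤ I.bot i := fun i hi => by
    by_contra hcon
    exact hi (by rw [hcount i, if_neg hcon])
  have hspec : ∀ i, 4 * I.demand i ≤ I.bot i →
      (p i ≠ 0 → I.bot i * (Z i + p i) + 4 * I.demand i * Y i < 6 * I.bot i) ∧
      (5 * I.bot i ≤ I.bot i * (Z i + p i) + 4 * I.demand i * Y i ∨ p i = 5) := fun i hi => by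
    have := raiseCount_spec (I.bot i) (Z i) (I.demand i) (Y i) 5
    rwa [← (hcount i).trans (if_pos hi)] at this
  refine ⟨rank, p, hinj, fun i j h => ?_, hsmall, fun i hi => ?_,
    fun i hi => ?_, fun i => ?_⟩
  · have := (hlt i j).1 h
    simp only [Before, hσ.target] at this
    omega
  · rw [hZ i]
    rcases (hspec i hi).2 with h | h
    · exact h
    -- Five raises alone contribute `5 * bot i`, so the limit in `raise 5` loses nothing.
    · rw [h]
      refine le_trans ?_ (Nat.le_add_right _ _)
      rw [mul_comm]
      exact Nat.mul_le_mul_left _ (Nat.le_add_left _ _)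
  · rw [hZ i]
    exact (hspec i (hsmall i hi)).1 hi
  · have hσ2 : τ.mem 2 = σ.mem 2 := run_mem _ rfl _
    rw [hS, mem_chosen, hs i i.2]
    refine and_congr_right fun _ => and_congr ⟨fun h j hj hr => ?_, fun h j hj hj' hr => ?_⟩
      ⟨fun h k => ?_, fun h k hk => ?_⟩
    · have := h j j.2 (mem_chosen.1 hj) (by rw [hσ2]; exact (hlt i j).1 hr)
      simpa [hτL.bag] using this
    · have := h ⟨j, hj⟩ (mem_chosen.2 hj') ((hlt i ⟨j, hj⟩).2 (by rw [← hσ2]; exact hr))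
      rw [← hτL.bag, ← hτL.bag] at this
      exact this
    · rw [hload, ← hτL.bot, ← hτL.bot, ← hτL.demand]
      exact h k k.2
    · have := h ⟨k, hk⟩
      rw [hload, ← hτL.bot, ← hτL.bot, ← hτL.demand] at this
      exact this

end BagUFP

/-! ### Bottleneck search, choice of the best set, and the final bound. -/

namespace BagUFP

open RAM RAM.Code

variable {I : BagUFP}

theorem inputState_mem {a : ℕ} (h : 5 < a) (i : ℕ) : I.inputState.mem a i = 0 := by
  obtain ⟨b, rfl⟩ : ∃ b, a = b + 6 := ⟨a - 6, by omega⟩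
  rfl

theorem toArray_val {k : ℕ} (f : Fin k → ℕ) (i : Fin k) : toArray f i = f i := by
  simp [toArray]

/-- The search for the bottleneck of a task. -/
theorem run_bottleneck {σ : State} (h0 : σ.reg 0 = I.m) (hcap : σ.mem 0 = toArray I.capacity)
    (hs : σ.mem 1 = toArray I.source) (ht : σ.mem 2 = toArray I.target) {i : Fin I.n}
    (h3 : σ.reg 3 = i) (h9 : σ.reg 9 = 0) :
    ((loop 4 0 (ite (.and (.and (.le (.arr 1 (.var 3)) (.var 4)) (.lt (.var 4) (.arr 2 (.var 3))))
      (.or (.eq (.var 9) (.const 0)) (.lt (.arr 0 (.var 4)) (.var 9))))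
      (assign 9 (.arr 0 (.var 4))) skip)).run σ).reg 9 = I.bot i := by
  -- The value 0 in register `9` means that no edge of the task has been met yet; it cannot be
  -- confused with a minimum because capacities are positive.
  have := run_loop (p := ite (.and (.and (.le (.arr 1 (.var 3)) (.var 4))
      (.lt (.var 4) (.arr 2 (.var 3))))
      (.or (.eq (.var 9) (.const 0)) (.lt (.arr 0 (.var 4)) (.var 9))))
      (assign 9 (.arr 0 (.var 4))) skip) (x := 4) (y := 0) (σ := σ) (fun k τ =>
      (τ.reg 9 = 0 ∧ ∀ e : Fin I.m, e < k → ¬ I.Uses i e) ∨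
      ∃ e : Fin I.m, I.Uses i e ∧ τ.reg 9 = I.capacity e ∧
        ∀ f : Fin I.m, f < k → I.Uses i f → I.capacity e ≤ I.capacity f)
    (Or.inl ⟨by simpa [State.setReg_reg] using h9, fun e he => absurd he (Nat.not_lt_zero _)⟩) ?_
  · rw [h0] at this
    rcases this with ⟨-, h⟩ | ⟨e, he, h, hmin⟩
    · obtain ⟨e, he, -⟩ := I.exists_bot i
      exact absurd he (h e e.2)
    · rw [h, bot_eq he fun f hf => hmin f f.2 hf]
  intro k hk τ h4 hreg hmem ih
  rw [h0] at hk
  have h3τ : τ.reg 3 = i := (hreg 3 (by norm_num) rfl).trans h3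
  have hc : τ.mem 0 k = I.capacity ⟨k, hk⟩ := by
    rw [hmem 0 rfl, hcap]; exact toArray_val I.capacity ⟨k, hk⟩
  rw [State.setReg_reg_of_ne _ _ (by norm_num), run_ite]
  simp only [Expr.holds_and, Expr.holds_or, Expr.holds_le, Expr.holds_lt, Expr.holds_eq,
    Expr.eval, h3τ, h4, hmem 1 rfl, hmem 2 rfl, hs, ht, toArray_val, hc]
  have hlast : ∀ f : Fin I.m, (f : ℕ) < k + 1 → (f : ℕ) < k ∨ f = ⟨k, hk⟩ := fun f hf => by
    rw [Fin.ext_iff]; simp only; omega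
  split_ifs with h
  · refine Or.inr ⟨⟨k, hk⟩, h.1, ?_, fun f hf hu => ?_⟩
    · simp [run, Expr.eval, h4, hc]
    · rcases hlast f hf with hfk | rfl
      · rcases ih with ⟨-, h'⟩ | ⟨e, he, h', hmin⟩
        · exact absurd hu (h' f hfk)
        · have := hmin f hfk hu
          have := I.capacity_pos e
          omega
      · exact le_rfl
  · rw [run]
    rcases ih with ⟨h', hn⟩ | ⟨e, he, h', hmin⟩
    · refine Or.inl ⟨h', fun f hf hu => ?_⟩
      rcases hlast f hf with hfk | rfl
      · exact hn f hfk hu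
      · exact h ⟨hu, Or.inl h'⟩
    · refine Or.inr ⟨e, he, h', fun f hf hu => ?_⟩
      rcases hlast f hf with hfk | rfl
      · exact hmin f hfk hu
      · by_contra hcon
        exact h ⟨hu, Or.inr (by omega)⟩

theorem loaded_bottlenecks : I.Loaded (bottlenecks.run I.inputState) := by
  have hmem : ∀ a, a ≠ 7 → (bottlenecks.run I.inputState).mem a = I.inputState.mem a :=
    fun a ha => run_mem _ (by simp [bottlenecks, stores, ha.symm]) _
  refine ⟨by rw [run_reg _ rfl]; rfl, fun i => ?_, fun i => ?_, fun i => ?_, fun i => ?_, ?_⟩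
  · rw [hmem 1 (by norm_num)]; exact toArray_val _ i
  · rw [hmem 2 (by norm_num)]; exact toArray_val _ i
  · rw [hmem 3 (by norm_num)]; exact toArray_val _ i
  · rw [hmem 5 (by norm_num)]; exact toArray_val _ i
  have := run_loop (p := seq (assign 9 (.const 0)) (seq
    (loop 4 0 (ite (.and (.and (.le (.arr 1 (.var 3)) (.var 4)) (.lt (.var 4) (.arr 2 (.var 3))))
      (.or (.eq (.var 9) (.const 0)) (.lt (.arr 0 (.var 4)) (.var 9))))
      (assign 9 (.arr 0 (.var 4))) skip))
    (store 7 (.var 3) (.var 9)))) (x := 3) (y := 1) (σ := I.inputState)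
    (fun k τ => ∀ i : Fin I.n, i < k → τ.mem 7 i = I.bot i)
    (fun i hi => absurd hi (Nat.not_lt_zero _)) ?_
  · exact fun i => this i i.2
  intro k hk τ h3 hreg hm ih i hi
  change k < I.n at hk
  rw [run_seq, run_seq]
  set τ₁ := (assign 9 (.const 0)).run τ with hτ₁
  have h13 : τ₁.reg 3 = k := (State.setReg_reg_of_ne _ _ (by norm_num)).trans h3
  have hb := run_bottleneck (I := I) (σ := τ₁) (i := ⟨k, hk⟩)
    ((State.setReg_reg_of_ne _ _ (by norm_num)).trans (hreg 0 (by norm_num) rfl))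
    (hm 0 rfl) (hm 1 rfl) (hm 2 rfl) h13 (State.setReg_reg_self _ _ _)
  set search := loop 4 0 (ite (.and (.and (.le (.arr 1 (.var 3)) (.var 4))
      (.lt (.var 4) (.arr 2 (.var 3))))
      (.or (.eq (.var 9) (.const 0)) (.lt (.arr 0 (.var 4)) (.var 9))))
      (assign 9 (.arr 0 (.var 4))) skip) with hsearch
  have h23 : (search.run τ₁).reg 3 = k := by rw [run_reg _ rfl, h13]
  have hm7 : (search.run τ₁).mem 7 = τ.mem 7 := run_mem _ rfl _
  rw [run, State.setReg_mem]
  simp only [State.setMem, Expr.eval, h23, hb, Function.update_self, hm7]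
  rcases eq_or_ne (i : ℕ) k with h | h
  · subst h
    rw [Function.update_self]
  · rw [Function.update_of_ne h]
    exact ih i (by omega)

theorem run_count {σ : State} (h1 : σ.reg 1 = I.n) {acc A : ℕ} (hacc : acc ≠ 4) (hacc' : acc ≠ 1) :
    ((sumLoop acc 4 1 (.arr A (.var 4)) (.const 1)).run σ).reg acc = (I.chosen A σ).card := by
  rw [run_sumLoop hacc hacc'.symm (by simpa [Expr.reads] using hacc.symm) rfl, h1,
    Finset.sum_range, chosen, Finset.card_filter]
  simp [Expr.eval]

/-- Array `6` stays one of the candidate sets, hence feasible, and its cardinality never decreases;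
so after four calls it dominates all candidates. -/
theorem run_keepBest {σ : State} (h1 : σ.reg 1 = I.n) {X : ℕ} (hX : X ≠ 6) :
    (I.chosen 6 ((keepBest X).run σ) = I.chosen 6 σ ∨
      I.chosen 6 ((keepBest X).run σ) = I.chosen X σ) ∧
    (I.chosen 6 σ).card ≤ (I.chosen 6 ((keepBest X).run σ)).card ∧
    (I.chosen X σ).card ≤ (I.chosen 6 ((keepBest X).run σ)).card := by
  rw [keepBest, run_seq, run_seq, run_ite]
  set τ₁ := (sumLoop 7 4 1 (.arr 6 (.var 4)) (.const 1)).run σ with hτ₁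
  set τ₂ := (sumLoop 8 4 1 (.arr X (.var 4)) (.const 1)).run τ₁ with hτ₂
  have hm₁ : τ₁.mem = σ.mem := sumLoop_mem _ _ _ _ _ _
  have hm₂ : τ₂.mem = σ.mem := (sumLoop_mem _ _ _ _ _ _).trans hm₁
  have h11 : τ₁.reg 1 = I.n := by rw [hτ₁, run_reg _ rfl, h1]
  have h21 : τ₂.reg 1 = I.n := by rw [hτ₂, run_reg _ rfl, h11]
  have h7 : τ₂.reg 7 = (I.chosen 6 σ).card := by
    rw [hτ₂, run_reg _ rfl, hτ₁, run_count h1 (by norm_num) (by norm_num)]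
  have h8 : τ₂.reg 8 = (I.chosen X σ).card := by
    rw [hτ₂, run_count h11 (by norm_num) (by norm_num), chosen_congr (congrFun hm₁ X)]
  simp only [Expr.holds_lt, Expr.eval, h7, h8]
  split_ifs with h
  · have hcopy : I.chosen 6 ((loop 4 1 (store 6 (.var 4) (.arr X (.var 4)))).run τ₂) =
        I.chosen X σ := by
      have := run_loop (p := store 6 (.var 4) (.arr X (.var 4))) (x := 4) (y := 1) (σ := τ₂)
        (fun k τ => ∀ i < k, τ.mem 6 i = σ.mem X i)
        (fun i hi => absurd hi (Nat.not_lt_zero _)) fun k hk τ h4 hreg hmem ih i hi => by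
          have hXm : τ.mem X = σ.mem X := (hmem X (by simp [stores, hX.symm])).trans
            (congrFun hm₂ X)
          rw [run, State.setReg_mem]
          simp only [State.setMem, Expr.eval, h4, Function.update_self, hXm]
          rcases eq_or_ne i k with rfl | hne
          · rw [Function.update_self]
          · rw [Function.update_of_ne hne]
            exact ih i (by omega)
      ext i
      rw [mem_chosen, mem_chosen, this i (by rw [h21]; exact i.2)]
    rw [hcopy]
    exact ⟨Or.inr rfl, h.le, le_rfl⟩
  · rw [run, chosen_congr (congrFun hm₂ 6)]
    exact ⟨Or.inl rfl, le_rfl, not_lt.1 h⟩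

/-- The algorithm finds a feasible set with at least a fraction `1 / 69` of the largest number of
tasks. -/
theorem run_bagUFP : I.Feasible (I.output (RAM.Code.bagUFP.run I.inputState)) ∧
    ∀ O, I.Feasible O → O.card ≤ 69 * (I.output (RAM.Code.bagUFP.run I.inputState)).card := by
  change I.Feasible (I.chosen 6 _) ∧ ∀ O, I.Feasible O → O.card ≤ 69 * (I.chosen 6 _).card
  simp only [RAM.Code.bagUFP, run_seq]
  set σ₁ := bottlenecks.run I.inputState with h₁
  have L₁ : I.Loaded σ₁ := loaded_bottlenecks
  have z₁ : ∀ a, 7 < a → ∀ i, σ₁.mem a i = 0 := fun a ha i => by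
    rw [h₁, run_mem _ (by simp [bottlenecks, stores]; omega), inputState_mem (by omega)]
  have z₁' : ∀ i, σ₁.mem 6 i = 0 := fun i => by rw [h₁, run_mem _ rfl, inputState_mem (by omega)]
  set σ₂ := greedyIntervals.run σ₁ with h₂
  have L₂ : I.Loaded σ₂ := L₁.run _ rfl (by rintro a (rfl | rfl | rfl | rfl | rfl) <;> rfl)
  set σ₃ := greedyLarge.run σ₂ with h₃
  have L₃ : I.Loaded σ₃ := L₂.run _ rfl (by rintro a (rfl | rfl | rfl | rfl | rfl) <;> rfl)
  set σ₄ := greedyMedium.run σ₃ with h₄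
  have L₄ : I.Loaded σ₄ := L₃.run _ rfl (by rintro a (rfl | rfl | rfl | rfl | rfl) <;> rfl)
  have z₃ : ∀ i, σ₂.mem 11 i = 0 := fun i => by rw [h₂, run_mem _ rfl, z₁ _ (by norm_num)]
  have z₄ : ∀ i, σ₃.mem 12 i = 0 := fun i => by
    rw [h₃, run_mem _ rfl, h₂, run_mem _ rfl, z₁ _ (by norm_num)]
  have z₅ : ∀ i, σ₄.mem 8 i = 0 := fun i => by
    rw [h₄, run_mem _ rfl, h₃, run_mem _ rfl, h₂, run_mem _ rfl, z₁ _ (by norm_num)]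
  have z₆ : ∀ i, σ₄.mem 13 i = 0 := fun i => by
    rw [h₄, run_mem _ rfl, h₃, run_mem _ rfl, h₂, run_mem _ rfl, z₁ _ (by norm_num)]
  have hG := L₁.greedyIntervals (z₁ 10 (by norm_num))
  have hA := L₂.greedyLarge z₃
  have hB := L₃.greedyMedium z₄
  obtain ⟨rank, p, hS⟩ := L₄.isLocalRatio z₅ z₆
  rw [← h₂] at hG
  rw [← h₃] at hA
  rw [← h₄] at hB
  set σ₅ := raiseSmall.run σ₄ with h₅
  set σ₆ := selectSmall.run σ₅ with h₆
  have m10 : σ₆.mem 10 = σ₂.mem 10 := by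
    rw [h₆, run_mem _ rfl, h₅, run_mem _ rfl, h₄, run_mem _ rfl, h₃, run_mem _ rfl]
  have m11 : σ₆.mem 11 = σ₃.mem 11 := by
    rw [h₆, run_mem _ rfl, h₅, run_mem _ rfl, h₄, run_mem _ rfl]
  have m12 : σ₆.mem 12 = σ₄.mem 12 := by rw [h₆, run_mem _ rfl, h₅, run_mem _ rfl]
  -- The output array is untouched before the comparisons, so they start from the empty set, which
  -- is feasible.
  have m6 : I.chosen 6 σ₆ = ∅ := by
    have : σ₆.mem 6 = σ₁.mem 6 := by
      rw [h₆, run_mem _ rfl, h₅, run_mem _ rfl, h₄, run_mem _ rfl, h₃, run_mem _ rfl, h₂,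
        run_mem _ rfl]
    ext i
    simp [this, z₁']
  have r6 : σ₆.reg 1 = I.n := by rw [h₆, run_reg _ rfl, h₅, run_reg _ rfl, L₄.num]
  rw [← chosen_congr m10] at hG
  rw [← chosen_congr m11] at hA
  rw [← chosen_congr m12] at hB
  clear_value σ₆
  clear h₆
  have hbest : ∀ X, X ≠ 6 → ∀ τ : State, τ.reg 1 = I.n → τ.mem X = σ₆.mem X →
      I.Feasible (I.chosen 6 τ) → I.Feasible (I.chosen X σ₆) →
      I.Feasible (I.chosen 6 ((keepBest X).run τ)) ∧
      (I.chosen 6 τ).card ≤ (I.chosen 6 ((keepBest X).run τ)).card ∧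
      (I.chosen X σ₆).card ≤ (I.chosen 6 ((keepBest X).run τ)).card := by
    intro X hX τ hτ hm hf hfX
    obtain ⟨h1, h2, h3⟩ := run_keepBest hτ hX
    rw [chosen_congr hm] at h1 h3
    refine ⟨?_, h2, h3⟩
    rcases h1 with h1 | h1 <;> rw [h1] <;> assumption
  have fG := hG.feasible fun i hi => by omega
  have fA := hA.feasible fun i hi => by omega
  have fB := hB.feasible fun i hi => by omega
  have fS := hS.feasible
  have fE : I.Feasible (I.chosen 6 σ₆) := by
    rw [m6]
    exact ⟨fun e => by simp, fun i hi => by simp at hi⟩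
  obtain ⟨f₁, -, c₁⟩ := hbest 10 (by norm_num) _ r6 rfl fE fG
  obtain ⟨f₂, b₂, c₂⟩ := hbest 11 (by norm_num) ((keepBest 10).run σ₆)
    (by rw [run_reg _ rfl, r6]) (run_mem _ rfl _) f₁ fA
  obtain ⟨f₃, b₃, c₃⟩ := hbest 12 (by norm_num) ((keepBest 11).run ((keepBest 10).run σ₆))
    (by rw [run_reg _ rfl, run_reg _ rfl, r6]) ((run_mem _ rfl _).trans (run_mem _ rfl _)) f₂ fB
  obtain ⟨f₄, b₄, c₄⟩ := hbest 13 (by norm_num)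
    ((keepBest 12).run ((keepBest 11).run ((keepBest 10).run σ₆)))
    (by rw [run_reg _ rfl, run_reg _ rfl, run_reg _ rfl, r6])
    ((run_mem _ rfl _).trans ((run_mem _ rfl _).trans (run_mem _ rfl _))) f₃ fS
  refine ⟨f₄, fun O hO => ?_⟩
  have := hO.card_le_of_parts hS hA hB hG
  omega

/-! ### Running time -/

theorem size_toArray_le {k : ℕ} {f : Fin k → ℕ} {B : ℕ} (h : ∀ i, Nat.size (f i) ≤ B) (i : ℕ) :
    Nat.size (toArray f i) ≤ B := by
  unfold toArray
  split_ifs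
  · exact h _
  · simp

/-- The number `n` is written in binary, but the `n` listed tasks each contribute at least one unit;
so loops up to `n` are polynomial in the size. The same holds for `m` through the capacities. -/
theorem n_le_size : I.n ≤ I.size := by
  have : ∑ _i : Fin I.n, 1 ≤ ∑ i, ((Nat.size (I.source i) + 1) + (Nat.size (I.target i) + 1) +
      (Nat.size (I.demand i) + 1) + (Nat.size (I.weight i) + 1) + (Nat.size (I.bag i) + 1)) :=
    Finset.sum_le_sum fun i _ => by omega
  simp only [Finset.sum_const, Finset.card_univ, Fintype.card_fin, smul_eq_mul, mul_one] at this
  unfold size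
  omega

theorem m_le_size : I.m ≤ I.size := by
  have : ∑ _e : Fin I.m, 1 ≤ ∑ e, (Nat.size (I.capacity e) + 1) :=
    Finset.sum_le_sum fun i _ => by omega
  simp only [Finset.sum_const, Finset.card_univ, Fintype.card_fin, smul_eq_mul, mul_one] at this
  unfold size
  omega

theorem bounded_inputState : I.inputState.Bounded I.size := by
  have hcap : ∀ e, Nat.size (I.capacity e) ≤ I.size := fun e => by
    have := Finset.single_le_sum (f := fun e => Nat.size (I.capacity e) + 1)
      (fun _ _ => Nat.zero_le _) (Finset.mem_univ e)
    unfold size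
    omega
  have htask : ∀ i, ((Nat.size (I.source i) + 1) + (Nat.size (I.target i) + 1) +
      (Nat.size (I.demand i) + 1) + (Nat.size (I.weight i) + 1) + (Nat.size (I.bag i) + 1)) ≤
      I.size := fun i => by
    have := Finset.single_le_sum (f := fun i => (Nat.size (I.source i) + 1) +
      (Nat.size (I.target i) + 1) + (Nat.size (I.demand i) + 1) + (Nat.size (I.weight i) + 1) +
      (Nat.size (I.bag i) + 1)) (fun _ _ => Nat.zero_le _) (Finset.mem_univ i)
    unfold size
    omega
  constructor
  · intro x
    match x with
    | 0 => change Nat.size I.m ≤ _; unfold size; omega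
    | 1 => change Nat.size I.n ≤ _; unfold size; omega
    | x + 2 => change Nat.size 0 ≤ _; simp
  · intro a i
    match a with
    | 0 => exact size_toArray_le hcap i
    | 1 => exact size_toArray_le (fun i => by have := htask i; omega) i
    | 2 => exact size_toArray_le (fun i => by have := htask i; omega) i
    | 3 => exact size_toArray_le (fun i => by have := htask i; omega) i
    | 4 => exact size_toArray_le (fun i => by have := htask i; omega) i
    | 5 => exact size_toArray_le (fun i => by have := htask i; omega) i
    | a + 6 => change Nat.size 0 ≤ _; simp

end BagUFP

theorem mainTheorem10 :
    ∃ p : RAM.Prog, BagUFP.IsApproximationAlgorithm BagUFP.Unweighted 69 p := by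
  obtain ⟨G, C, h⟩ := RAM.Code.bagUFP.exists_polynomial_bound RAM.Code.wf_bagUFP
  refine ⟨RAM.Code.bagUFP.toProg, C.comp (2 * .X), fun I hI => ?_⟩
  -- The instance size serves both as loop bound and as bit bound, hence the argument `2 * .X` of
  -- the cost polynomial.
  obtain ⟨k, hk, hle, -⟩ := h I.size I.size I.inputState BagUFP.m_le_size BagUFP.n_le_size
    BagUFP.bounded_inputState
  obtain ⟨hf, hc⟩ := BagUFP.run_bagUFP (I := I)
  refine ⟨_, k, hk, ?_, hf, BagUFP.opt_le_of_card_le hI hc⟩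
  simpa [Polynomial.eval_comp, two_mul] using hle
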